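/- **Theorem.** Every hyperbolic group $\Gamma$ embeds into a hyperbolic group $\overline{\Gamma}$ which is torsion-saturated and such that the class of $\overline{\Gamma}$-limit groups is closed under amalgamated free products and under HNN extensions over finite groups. Here: - A group is *hyperbolic* if it has a finite generating set whose Cayley graph is hyperbolic, that is, there is a constant $\delta$ such that every point on a side of a geodesic triangle is at distance at most $\delta$ from the union of the two other sides. - For an element $g$ of infinite order contained in a unique maximal virtually abelian subgroup of $G$, this subgroup is denoted by $M(g)$. - A group $G$ is *torsion-saturated* if (1) for every isomorphism $\alpha\colon F_1\to F_2$ between finite subgroups $F_1,F_2$ of $G$ there is $g\in G$ with $gxg^{-1}=\alpha(x)$ for all $x\in F_1$; and (2) for every finite subgroup $F$ of $G$ there is a sequence $(g_n)_{n\in\mathbb{N}}$ of elements of $G$ of infinite order such that $M(g_n)$ is defined and $M(g_n)=\langle g_n\rangle\times F$ (internal direct product) for every $n$, and $M(g_n)\neq M(g_m)$ whenever $n\neq m$. - A group $L$ is a *$\overline{\Gamma}$-limit group* if it is finitely generated and fully residually $\overline{\Gamma}$: for every finite subset $E\subset L$ there is a homomorphism $L\to\overline{\Gamma}$ which is injective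 on $E$. - Closure means: if $A$ and $B$ are $\overline{\Gamma}$-limit groups and $F$ is a finite group with injective homomorphisms $F\to A$ and $F\to B$, then $A\ast_F B$ is a $\overline{\Gamma}$-limit group; and if $H$ is a $\overline{\Gamma}$-limit group and $\alpha\colon F_1\to F_2$ is an isomorphism between finite subgroups of $H$, then the HNN extension $H\ast_\alpha=\langle H,t\mid txt^{-1}=\alpha(x)\ \forall x\in F_1\rangle$ is a $\overline{\Gamma}$-limit group. -/

import Mathlib

universe u

/-- A graph has `δ`-slim geodesic triangles: every vertex on a side of a geodesic triangle is at
distance at most `δ` from the union of the two other sides. -/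
def SimpleGraph.HasSlimTriangles {V : Type*} (X : SimpleGraph V) (δ : ℕ) : Prop :=
  ∀ (x y z : V) (p : X.Walk x y) (q : X.Walk y z) (r : X.Walk z x),
    p.length = X.dist x y → q.length = X.dist y z → r.length = X.dist z x →
    ∀ v ∈ p.support, ∃ w, (w ∈ q.support ∨ w ∈ r.support) ∧ X.dist v w ≤ δ

/-- A group is hyperbolic (in the sense of Gromov) if it has a finite generating set whose Cayley
graph has uniformly slim geodesic triangles. -/
def IsHyperbolicGroup (G : Type*) [Group G] : Prop :=
  ∃ S : Set G, S.Finite ∧ Subgroup.closure S = ⊤ ∧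
    ∃ δ : ℕ, (SimpleGraph.mulCayley S).HasSlimTriangles δ

/-- A group is virtually abelian if it has an abelian subgroup of finite index. -/
def IsVirtuallyAbelian (G : Type*) [Group G] : Prop :=
  ∃ A : Subgroup G, (∀ a ∈ A, ∀ b ∈ A, a * b = b * a) ∧ A.FiniteIndex

/-- `M = M(g)`: the element `g` is contained in a unique maximal virtually abelian subgroup,
and this subgroup is `M`. -/
def IsMaximalVirtuallyAbelianAt {G : Type*} [Group G] (g : G) (M : Subgroup G) : Prop :=
  g ∈ M ∧ Maximal (fun H : Subgroup G => IsVirtuallyAbelian H) M ∧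
    ∀ N : Subgroup G, g ∈ N → Maximal (fun H : Subgroup G => IsVirtuallyAbelian H) N → N = M

/-- `M` is the internal direct product `A × B` of its subgroups `A` and `B`. -/
def IsInternalDirectProduct {G : Type*} [Group G] (M A B : Subgroup G) : Prop :=
  M = A ⊔ B ∧ A ⊓ B = ⊥ ∧ ∀ a ∈ A, ∀ b ∈ B, a * b = b * a

/-- Torsion-saturated groups. -/
structure IsTorsionSaturated (G : Type*) [Group G] : Prop where
  /-- Every isomorphism between finite subgroups is induced by a conjugation. -/
  conj_of_finite : ∀ (F₁ F₂ : Subgroup G) (α : F₁ ≃* F₂), Finite F₁ → Finite F₂ →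
    ∃ g : G, ∀ x : F₁, g * (x : G) * g⁻¹ = (α x : G)
  /-- For every finite subgroup `F` there are elements `g 0, g 1, …` of infinite order
  with `M(g n) = ⟨g n⟩ × F`, the subgroups `M(g n)` being pairwise distinct. -/
  exists_maximal : ∀ F : Subgroup G, Finite F → ∃ (g : ℕ → G) (M : ℕ → Subgroup G),
    (∀ n, ¬ IsOfFinOrder (g n)) ∧
    (∀ n, IsMaximalVirtuallyAbelianAt (g n) (M n)) ∧
    (∀ n, IsInternalDirectProduct (M n) (Subgroup.zpowers (g n)) F) ∧
    ∀ m n, m ≠ n → M m ≠ M n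

/-- `G` is fully residually `Γ`: for every finite subset of `G` there is a homomorphism to `Γ`
which is injective on it. -/
def IsFullyResidually (Γ G : Type*) [Group Γ] [Group G] : Prop :=
  ∀ E : Set G, E.Finite → ∃ f : G →* Γ, Set.InjOn f E

/-- `G` is a `Γ`-limit group: it is finitely generated and fully residually `Γ`. -/
def IsLimitGroup (Γ G : Type*) [Group Γ] [Group G] : Prop :=
  Group.FG G ∧ IsFullyResidually Γ G

/-- The class of `Γ`-limit groups is closed under amalgamated free products `A₀ ∗_F A₁` over
finite groups `F`. -/
def LimitGroupsClosedUnderAmalgams (Γ : Type u) [Group Γ] : Prop :=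
  ∀ (A : Fin 2 → Type u) [∀ i, Group (A i)] (F : Type u) [Group F] [Finite F]
    (φ : ∀ i, F →* A i), (∀ i, Function.Injective (φ i)) →
    (∀ i, IsLimitGroup Γ (A i)) → IsLimitGroup Γ (Monoid.PushoutI φ)

/-- The class of `Γ`-limit groups is closed under HNN extensions over finite groups. -/
def LimitGroupsClosedUnderHNN (Γ : Type u) [Group Γ] : Prop :=
  ∀ (H : Type u) [Group H] (F₁ F₂ : Subgroup H) [Finite F₁] [Finite F₂] (α : F₁ ≃* F₂),
    IsLimitGroup Γ H → IsLimitGroup Γ (HNNExtension H F₁ F₂ α)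

/-! Up to conjugation the finite subgroups of $\Gamma$ lie in a finite set $T$, a ball of a Cayley
graph. For every isomorphism between subgroups contained in $T$, adjoin to $\Gamma$ two stable
letters inducing it by conjugation. There are finitely many, so the result $\overline\Gamma$
(`Saturation.Saturated`) is an iterated HNN extension over finite groups. Hence it contains $\Gamma$
and is hyperbolic: once the associated subgroups are among the generators, the base group of an HNN
extension is isometrically embedded, and a geodesic triangle is compared with a triangle in the base
(`HNNExtension.slimIntervals_wdist`). The guessing geodesics criterion allows the change of
generators.

A finite subgroup of $\overline\Gamma$ fixes a vertex of the tree at each stage, so it is conjugate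
into $\Gamma$ and then into $T$. Thus every isomorphism between finite subgroups is, up to
conjugations, induced by a stable letter (`Saturation.conjOfFinite`).

Everything else rests on the notion `IsMover`. The identity of a subgroup $F$ in $T$ has two stable
letters $t$ and $s$, both commuting with $F$. Reading $\overline\Gamma$ as an HNN extension with
stable letter $t$ along the identity of $F$, normal forms show that $t$ is a mover. Exponent sums
show that no nontrivial power of $s$ lies in $\langle t\rangle F$. So the conjugates $s^n t s^{-n}$
are movers whose subgroups $\langle s^n t s^{-n}\rangle F$ meet pairwise in $F$. These are the
required maximal virtually abelian subgroups. Moreover any finite set disjoint from $F$ is avoided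
by one of them.

For $A\ast_F B$ and a finite set $E$, take homomorphisms of the factors to $\overline\Gamma$ that
are injective on $F$ and on the letters of the normal forms of $E$, and conjugate them to agree on
$F$. Choose a mover $g$ of the image of $F$ such that $\langle g\rangle F$ avoids the images of the
letters, and conjugate the two homomorphisms by $g^{-k}$ and $g^k$. Reduced words become products of
large powers of $g$ without cancellation, which are nontrivial for large $k$. For an HNN extension,
the stable letter goes to $cg^k$, where conjugation by $c$ realizes the image of $\alpha$. -/

/-! ### Geodesic metrics with values in the natural numbers -/

/-- A metric with values in `ℕ` such that any two points are joined by a discrete geodesic. -/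
structure IsGeodesicDist {V : Type*} (d : V → V → ℕ) : Prop where
  eq_of_zero : ∀ {x y}, d x y = 0 → x = y
  self : ∀ x, d x x = 0
  comm : ∀ x y, d x y = d y x
  triangle : ∀ x y z, d x z ≤ d x y + d y z
  split : ∀ x y k, k ≤ d x y → ∃ v, d x v = k ∧ d x v + d v y = d x y

/-- The point `v` lies on a geodesic from `x` to `y`. -/
def IsBetween {V : Type*} (d : V → V → ℕ) (x v y : V) : Prop := d x v + d v y = d x y

/-- Geodesic triangles are `δ`-slim, in terms of intervals. -/
def SlimIntervals {V : Type*} (d : V → V → ℕ) (δ : ℕ) : Prop :=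
  ∀ x y z v, IsBetween d x v y → ∃ w, (IsBetween d x w z ∨ IsBetween d z w y) ∧ d v w ≤ δ

namespace IsGeodesicDist

variable {V : Type*} {d : V → V → ℕ} (hd : IsGeodesicDist d)
include hd

theorem btw_left (x y : V) : IsBetween d x x y := by simp [IsBetween, hd.self]

theorem btw_right (x y : V) : IsBetween d x y y := by simp [IsBetween, hd.self]

theorem btw_symm {x v y : V} (h : IsBetween d x v y) : IsBetween d y v x := by
  have := hd.comm x v; have := hd.comm v y; have := hd.comm x y
  simp only [IsBetween] at *; omega

theorem btw_trans_left {x q a y : V} (h : IsBetween d x q a) (h' : IsBetween d x a y) : IsBetween d x q y := by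
  have := hd.triangle q a y; have := hd.triangle x q y
  simp only [IsBetween] at *; omega

theorem btw_trans_right {x q a y : V} (h : IsBetween d a q y) (h' : IsBetween d x a y) : IsBetween d x q y := by
  have := hd.triangle x a q; have := hd.triangle x q y
  simp only [IsBetween] at *; omega

theorem btw_mid {x f v f' y : V} (h : IsBetween d x f v) (h' : IsBetween d v f' y) (hv : IsBetween d x v y) :
    IsBetween d f v f' := by
  have := hd.triangle x f f'; have := hd.triangle x f' y; have := hd.triangle f v f'
  simp only [IsBetween] at *; omega

/-- Following a geodesic from `x`, stop just before `P` fails. This provides the coarse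
connectedness in the guessing criterion when the guessed sets are intervals. -/
theorem interval_chain {x y : V} (P Q : V → Prop) (hx : P x)
    (hy : Q y) (hPQ : ∀ v, IsBetween d x v y → P v ∨ Q v) :
    ∃ w w', IsBetween d x w y ∧ IsBetween d x w' y ∧ P w ∧ Q w' ∧ d w w' ≤ 1 := by
  suffices ∀ n w, d w y = n → IsBetween d x w y → P w →
      ∃ w w', IsBetween d x w y ∧ IsBetween d x w' y ∧ P w ∧ Q w' ∧ d w w' ≤ 1 from
    this _ x rfl (hd.btw_left x y) hx
  intro n
  induction n with
  | zero =>
    intro w h0 hw hP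
    obtain rfl := hd.eq_of_zero h0
    exact ⟨w, w, hw, hw, hP, hy, by simp [hd.self]⟩
  | succ n ih =>
    intro w hn hw hP
    obtain ⟨w', h1, h2⟩ := hd.split w y 1 (by omega)
    have hw' : IsBetween d x w' y := hd.btw_trans_right h2 hw
    rcases hPQ w' hw' with h | h
    · exact ih w' (by omega) hw' h
    · exact ⟨w, w', hw, hw', hP, h, h1.le⟩

/-! ### Guessing geodesics -/

section Guess

variable {L : V → V → Set V} {h : ℕ}

/-- Halving the interval doubles the admissible length at the cost of one thin triangle, so the
error grows only logarithmically with the distance. -/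
theorem guess_log
    (thin : ∀ x y z, ∀ w ∈ L x y, ∃ w', (w' ∈ L x z ∨ w' ∈ L z y) ∧ d w w' ≤ h)
    (short : ∀ x y, d x y ≤ 1 → ∀ w ∈ L x y, d x w ≤ h)
    (n : ℕ) : ∀ x y, d x y ≤ 2 ^ n → ∀ w ∈ L x y, ∃ p, IsBetween d x p y ∧ d w p ≤ (n + 1) * h := by
  induction n with
  | zero =>
    intro x y hxy w hw
    refine ⟨x, hd.btw_left x y, ?_⟩
    have := short x y (by simpa using hxy) w hw
    rw [hd.comm]; omega
  | succ n ih =>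
    intro x y hxy w hw
    obtain ⟨m, h1, h2⟩ := hd.split x y (d x y / 2) (by omega)
    have hp : 2 ^ (n + 1) = 2 * 2 ^ n := by ring
    obtain ⟨w', hw', hww⟩ := thin x y m w hw
    have key : ∃ p, IsBetween d x p y ∧ d w' p ≤ (n + 1) * h := by
      rcases hw' with hw' | hw'
      · obtain ⟨p, hp1, hp2⟩ := ih x m (by omega) w' hw'
        exact ⟨p, hd.btw_trans_left hp1 h2, hp2⟩
      · obtain ⟨p, hp1, hp2⟩ := ih m y (by omega) w' hw'
        exact ⟨p, hd.btw_trans_right hp1 h2, hp2⟩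
    obtain ⟨p, hp1, hp2⟩ := key
    refine ⟨p, hp1, ?_⟩
    have := hd.triangle w w' p
    have : (n + 1 + 1) * h = (n + 1) * h + h := by ring
    omega

/-- Bootstraps the logarithmic bound to a uniform one, by induction on the distance. Around the
point of the interval nearest to `w` a window of length linear in `m` is cut out: outside of it the
induction hypothesis applies, inside of it the logarithmic bound. -/
theorem guess_close
    (thin : ∀ x y z, ∀ w ∈ L x y, ∃ w', (w' ∈ L x z ∨ w' ∈ L z y) ∧ d w w' ≤ h)
    (short : ∀ x y, d x y ≤ 1 → ∀ w ∈ L x y, d x w ≤ h) :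
    ∃ m, ∀ x y, ∀ w ∈ L x y, ∃ p, IsBetween d x p y ∧ d w p ≤ m := by
  -- The window below has length at most `2 * (2 * m + 4 * h + 1)`. It must be at most `2 ^ N`,
  -- while `m` is only linear in `N`.
  obtain ⟨N, m, hm, hN⟩ : ∃ N m, m = (N + 4) * h ∧ 4 * m + 8 * h + 2 ≤ 2 ^ N := by
    refine ⟨2 * h + 10, _, rfl, ?_⟩
    have h1 : h + 1 ≤ 2 ^ h := Nat.lt_two_pow_self
    have h2 : 2 ^ (2 * h + 10) = (2 ^ h) * (2 ^ h) * 1024 := by ring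
    rw [h2]
    have h3 := Nat.mul_le_mul h1 h1
    nlinarith
  have hm' : m = (N + 1) * h + 3 * h := by rw [hm]; ring
  refine ⟨m, fun x y => ?_⟩
  generalize hn : d x y = n
  induction n using Nat.strong_induction_on generalizing x y with
  | _ n ih =>
  intro w hw
  classical
  rcases Nat.eq_zero_or_pos n with h0 | hpos
  · refine ⟨x, hd.btw_left x y, ?_⟩
    have := short x y (by omega) w hw
    rw [hd.comm]; omega
  have hex : ∃ l, ∃ p, IsBetween d x p y ∧ d w p = l := ⟨_, x, hd.btw_left x y, rfl⟩
  obtain ⟨p0, hp0, hl⟩ := Nat.find_spec hex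
  have hmin : ∀ p, IsBetween d x p y → d w p0 ≤ d w p := fun p hp => by
    rw [hl]; exact Nat.find_min' hex ⟨p, hp, rfl⟩
  refine ⟨p0, hp0, ?_⟩
  by_contra hcon
  push Not at hcon
  -- If `w` were close to a guessed set outside of the window, some `q` there would satisfy `d w q ≤
  -- m + 2 * h`. By minimality of `p0` then `d p0 q ≤ 2 * m + 4 * h`, which is less than the
  -- half-width of the window. The minimum covers windows that reach an endpoint.
  obtain ⟨a, ha1, ha2⟩ := hd.split p0 x (min (2 * m + 4 * h + 1) (d p0 x)) (min_le_right _ _)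
  obtain ⟨b, hb1, hb2⟩ := hd.split p0 y (min (2 * m + 4 * h + 1) (d p0 y)) (min_le_right _ _)
  have hpa : IsBetween d x a p0 := hd.btw_symm ha2
  have hpb : IsBetween d p0 b y := hb2
  have hab : IsBetween d a p0 b := hd.btw_mid hpa hpb hp0
  have hxa : IsBetween d x a y := hd.btw_trans_left hpa hp0
  have hxb : IsBetween d x b y := hd.btw_trans_right hpb hp0
  have hay : IsBetween d a b y := by
    have := hd.triangle a b y; have := hd.triangle x a b
    have := hd.triangle x b y; have := hd.triangle a p0 b
    have := hd.triangle a p0 y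
    simp only [IsBetween] at *; omega
  have hc1 := hd.comm p0 x
  have hc2 := hd.comm p0 a
  have hc3 := hd.comm a x
  obtain ⟨w', hw', hww'⟩ := thin x y a w hw
  rcases hw' with hw' | hw'
  · by_cases hK : d x p0 ≤ 2 * m + 4 * h + 1
    · have hax : x = a := hd.eq_of_zero (by simp only [IsBetween] at *; omega)
      subst hax
      have h1 := short x x (by simp [hd.self]) w' hw'
      have := hmin x (hd.btw_left x y)
      have := hd.triangle w w' x
      have := hd.comm w' x
      omega
    · obtain ⟨q, hq1, hq2⟩ := ih (d x a) (by simp only [IsBetween] at *; omega) x a rfl w' hw'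
      have h1 := hmin q (hd.btw_trans_left hq1 hxa)
      have h2 := hd.triangle w w' q
      have h3 := hd.triangle p0 w q
      have h4 := hd.comm p0 w
      have h5 := hd.comm p0 q
      have h6 := hd.triangle x q p0
      simp only [IsBetween] at *; omega
  obtain ⟨w'', hw'', hww''⟩ := thin a y b w' hw'
  rcases hw'' with hw'' | hw''
  · obtain ⟨q, hq1, hq2⟩ := hd.guess_log thin short N a b
      (by have := hd.comm a p0; simp only [IsBetween] at *; omega) w'' hw''
    have hq : IsBetween d x q y := hd.btw_trans_right (hd.btw_trans_left hq1 hay) hxa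
    have h1 := hmin q hq
    have h2 := hd.triangle w w' q
    have h3 := hd.triangle w' w'' q
    omega
  · by_cases hK : d p0 y ≤ 2 * m + 4 * h + 1
    · have hby : b = y := hd.eq_of_zero (by simp only [IsBetween] at *; omega)
      subst hby
      have h1 := short b b (by simp [hd.self]) w'' hw''
      have := hmin b (hd.btw_right x b)
      have := hd.triangle w w' b
      have := hd.triangle w' w'' b
      have := hd.comm w'' b
      omega
    · obtain ⟨q, hq1, hq2⟩ := ih (d b y) (by simp only [IsBetween] at *; omega) b y rfl w'' hw''
      have h1 := hmin q (hd.btw_trans_right hq1 hxb)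
      have h2 := hd.triangle w w' q
      have h2' := hd.triangle w' w'' q
      have h3 := hd.triangle p0 w q
      have h4 := hd.comm p0 w
      have h6 := hd.triangle p0 q y
      simp only [IsBetween] at *; omega

/-- The guessing geodesics criterion: a geodesic metric with a family of thin, coarsely connected
sets joining any two points is hyperbolic. -/
theorem slimIntervals_of_guess
    (thin : ∀ x y z, ∀ w ∈ L x y, ∃ w', (w' ∈ L x z ∨ w' ∈ L z y) ∧ d w w' ≤ h)
    (short : ∀ x y, d x y ≤ 1 → ∀ w ∈ L x y, d x w ≤ h)
    (conn : ∀ x y (P Q : V → Prop), P x → Q y → (∀ v ∈ L x y, P v ∨ Q v) →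
      ∃ w w', w ∈ L x y ∧ P w ∧ Q w' ∧ d w w' ≤ h)
    (left : ∀ x y, x ∈ L x y) (right : ∀ x y, y ∈ L x y) :
    ∃ δ, SlimIntervals d δ := by
  obtain ⟨m, hm⟩ := hd.guess_close thin short
  refine ⟨4 * m + 5 * h, fun x y z v hv => ?_⟩
  obtain ⟨w, w', hw, ⟨u, hu, hwu⟩, ⟨u', hu', hwu'⟩, hww'⟩ := conn x y
    (fun w => ∃ u ∈ L x v, d w u ≤ h) (fun w => ∃ u ∈ L v y, d w u ≤ h)
    ⟨x, left x v, by simp [hd.self]⟩ ⟨y, right v y, by simp [hd.self]⟩ (fun w hw => by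
      obtain ⟨w', hw', hd'⟩ := thin x y v w hw
      rcases hw' with hw' | hw'
      · exact Or.inl ⟨w', hw', hd'⟩
      · exact Or.inr ⟨w', hw', hd'⟩)
  obtain ⟨f, hf, hfu⟩ := hm x v u hu
  obtain ⟨f', hf', hfu'⟩ := hm v y u' hu'
  have hmid := hd.btw_mid hf hf' hv
  obtain ⟨w₁, hw₁, hd₁⟩ := thin x y z w hw
  have : ∃ p, (IsBetween d x p z ∨ IsBetween d z p y) ∧ d w₁ p ≤ m := by
    rcases hw₁ with hw₁ | hw₁
    · obtain ⟨p, hp, h⟩ := hm _ _ _ hw₁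
      exact ⟨p, Or.inl hp, h⟩
    · obtain ⟨p, hp, h⟩ := hm _ _ _ hw₁
      exact ⟨p, Or.inr hp, h⟩
  obtain ⟨p, hp, hpw⟩ := this
  refine ⟨p, hp, ?_⟩
  -- As `v` lies between `f` and `f'`, it is within `d f f' ≤ 2 * m + 3 * h` of `f`; the path from
  -- `f` to `p` through `u`, `w`, `w₁` adds `2 * m + 2 * h`.
  have h1 := hd.triangle v f p
  have h2 := hd.triangle f u p
  have h3 := hd.triangle u w p
  have h4 := hd.triangle w w₁ p
  have h5 := hd.triangle f u f'
  have h6 := hd.triangle u w f'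
  have h7 := hd.triangle w w' f'
  have h8 := hd.triangle w' u' f'
  have h9 := hd.comm u f
  have h10 := hd.comm w u
  have h11 := hd.comm f v
  simp only [IsBetween] at hmid
  omega

end Guess

end IsGeodesicDist

/-! ### Graph metrics -/

namespace SimpleGraph

variable {V W : Type*}

theorem Connected.isGeodesicDist {X : SimpleGraph V} (hX : X.Connected) :
    IsGeodesicDist X.dist where
  eq_of_zero h := hX.dist_eq_zero_iff.1 h
  self _ := dist_self
  comm _ _ := dist_comm
  triangle _ _ _ := hX.dist_triangle
  split x y k hk := by
    obtain ⟨p, hp⟩ := hX.exists_walk_length_eq_dist x y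
    refine ⟨p.getVert k, ?_⟩
    have h1 := dist_le (p.take k)
    have h2 := dist_le (p.drop k)
    have h3 := hX.dist_triangle (u := x) (v := p.getVert k) (w := y)
    rw [Walk.take_length] at h1
    rw [Walk.drop_length] at h2
    omega

theorem HasSlimTriangles.slimIntervals {X : SimpleGraph V} (hX : X.Connected) {δ : ℕ}
    (h : X.HasSlimTriangles δ) : SlimIntervals X.dist δ := by
  intro x y z v hv
  have key : ∀ (a b w : V) (p : X.Walk a b), p.length = X.dist a b → w ∈ p.support →
      IsBetween X.dist a w b := by
    classical
    intro a b w p hp hw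
    have h1 := dist_le (p.takeUntil w hw)
    have h2 := dist_le (p.dropUntil w hw)
    have h3 := congrArg Walk.length (p.take_spec hw)
    have h4 := hX.dist_triangle (u := a) (v := w) (w := b)
    rw [Walk.length_append] at h3
    simp only [IsBetween]; omega
  obtain ⟨p₁, hp₁⟩ := hX.exists_walk_length_eq_dist x v
  obtain ⟨p₂, hp₂⟩ := hX.exists_walk_length_eq_dist v y
  obtain ⟨q, hq⟩ := hX.exists_walk_length_eq_dist y z
  obtain ⟨r, hr⟩ := hX.exists_walk_length_eq_dist z x
  obtain ⟨w, hw, hvw⟩ := h x y z (p₁.append p₂) q r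
    (by rw [Walk.length_append, hp₁, hp₂]; exact hv) hq hr v (by simp)
  refine ⟨w, ?_, hvw⟩
  rcases hw with hw | hw
  · exact Or.inr (hX.isGeodesicDist.btw_symm (key _ _ _ q hq hw))
  · exact Or.inl (hX.isGeodesicDist.btw_symm (key _ _ _ r hr hw))

/-- A given side need not contain the point found in the interval. But two points of an interval at
equal distance from one end are `2 * δ`-close, by slimness of the triangle which has one of them as
third vertex. -/
theorem _root_.SlimIntervals.hasSlimTriangles {X : SimpleGraph V} (hX : X.Connected) {δ : ℕ}
    (h : SlimIntervals X.dist δ) : X.HasSlimTriangles (3 * δ) := by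
  have hd := hX.isGeodesicDist
  have key : ∀ (a b w : V) (p : X.Walk a b), p.length = X.dist a b → w ∈ p.support →
      IsBetween X.dist a w b := by
    classical
    intro a b w p hp hw
    have h1 := dist_le (p.takeUntil w hw)
    have h2 := dist_le (p.dropUntil w hw)
    have h3 := congrArg Walk.length (p.take_spec hw)
    have h4 := hX.dist_triangle (u := a) (v := w) (w := b)
    rw [Walk.length_append] at h3
    simp only [IsBetween]; omega
  have near : ∀ (a b w : V) (p : X.Walk a b), p.length = X.dist a b → IsBetween X.dist a w b →
      ∃ u ∈ p.support, X.dist w u ≤ 2 * δ := by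
    intro a b w p hp hw
    refine ⟨p.getVert (X.dist a w), p.getVert_mem_support _, ?_⟩
    set u := p.getVert (X.dist a w) with hu
    have hwle : X.dist a w ≤ X.dist a b := by simp only [IsBetween] at hw; omega
    have h1 := dist_le (p.take (X.dist a w))
    have h2 := dist_le (p.drop (X.dist a w))
    rw [Walk.take_length] at h1
    rw [Walk.drop_length] at h2
    have h3 := hd.triangle a u b
    obtain ⟨w', hw', hww'⟩ := h a b u w hw
    have h4 := hd.triangle a w w'
    have h5 := hd.triangle a w' w
    have h6 := hd.triangle w w' u
    have h7 := hd.triangle w w' b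
    have h8 := hd.comm w w'
    have h9 := hd.comm u w'
    have h10 := hd.triangle w' w b
    simp only [IsBetween, ← hu] at *
    omega
  intro x y z p q r hp hq hr v hv
  obtain ⟨w, hw, hvw⟩ := h x y z v (key _ _ _ p hp hv)
  rcases hw with hw | hw
  · obtain ⟨u, hu, hwu⟩ := near z x w r hr (hd.btw_symm hw)
    exact ⟨u, Or.inr hu, by have := hd.triangle v w u; omega⟩
  · obtain ⟨u, hu, hwu⟩ := near y z w q hq (hd.btw_symm hw)
    exact ⟨u, Or.inl hu, by have := hd.triangle v w u; omega⟩

theorem Connected.dist_map_le {X : SimpleGraph V} {Y : SimpleGraph W} (hX : X.Connected)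
    (f : X →g Y) (x y : V) : Y.dist (f x) (f y) ≤ X.dist x y := by
  obtain ⟨p, hp⟩ := hX.exists_walk_length_eq_dist x y
  rw [← hp, ← Walk.length_map f]
  exact dist_le _

end SimpleGraph

/-! ### Cayley graphs -/

section Cayley

open SimpleGraph

variable {G H : Type*} [Group G] [Group H]

theorem mulCayley_connected {S : Set G} (hS : Subgroup.closure S = ⊤) :
    (mulCayley S).Connected := by
  have key : ∀ g ∈ Subgroup.closure S, ∀ x, (mulCayley S).Reachable x (x * g) := by
    intro g hg
    induction hg using Subgroup.closure_induction with
    | mem s hs =>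
      intro x
      by_cases h : x = x * s
      · rw [← h]
      · exact Adj.reachable ((mulCayley_adj S _ _).2 ⟨h, Or.inl (by simpa using hs)⟩)
    | one => intro x; simp
    | mul a b _ _ ha hb => intro x; rw [← mul_assoc]; exact (ha x).trans (hb _)
    | inv a _ ha => intro x; simpa using (ha (x * a⁻¹)).symm
  refine { preconnected := fun x y => ?_, nonempty := ⟨1⟩ }
  simpa using key (x⁻¹ * y) (by rw [hS]; trivial) x

theorem mulCayley_dist_mul_left {S : Set G} (hS : Subgroup.closure S = ⊤) (g x y : G) :
    (mulCayley S).dist (g * x) (g * y) = (mulCayley S).dist x y := by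
  have hX := mulCayley_connected hS
  have key : ∀ g x y : G, (mulCayley S).dist (g * x) (g * y) ≤ (mulCayley S).dist x y :=
    fun g x y => hX.dist_map_le ⟨fun v => g * v, fun h => mulCayley_adj_mul_iff_right.2 h⟩ x y
  refine le_antisymm (key g x y) ?_
  simpa using key g⁻¹ (g * x) (g * y)

theorem mulCayley_dist_le_one {S : Set G} (x : G) {s : G} (hs : s ∈ S ∨ s⁻¹ ∈ S) :
    (mulCayley S).dist x (x * s) ≤ 1 := by
  by_cases h : x = x * s
  · rw [← h]; simp
  · refine (dist_eq_one_iff_adj.2 ((mulCayley_adj S _ _).2 ⟨h, ?_⟩)).le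
    rcases hs with hs | hs
    · exact Or.inl (by simpa using hs)
    · exact Or.inr (by simpa using hs)

theorem mulCayley_ball_finite {S : Set G} (hfin : S.Finite) (hS : Subgroup.closure S = ⊤) (n : ℕ) :
    {g : G | (mulCayley S).dist 1 g ≤ n}.Finite := by
  have hd := (mulCayley_connected hS).isGeodesicDist
  induction n with
  | zero =>
    refine (Set.finite_singleton (1 : G)).subset fun g hg => ?_
    exact (hd.eq_of_zero (Nat.le_zero.1 hg)).symm
  | succ n ih =>
    refine (ih.union (ih.mul (hfin.union hfin.inv))).subset fun g hg => ?_
    rcases Nat.lt_or_ge ((mulCayley S).dist 1 g) (n + 1) with h | h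
    · exact Or.inl (Nat.lt_succ_iff.1 h)
    · have hg' : (mulCayley S).dist 1 g = n + 1 := le_antisymm hg h
      obtain ⟨v, h1, h2⟩ := hd.split 1 g n (by omega)
      have hadj : (mulCayley S).Adj v g := dist_eq_one_iff_adj.1 (by omega)
      refine Or.inr (Set.mem_mul.2 ⟨v, h1.le, v⁻¹ * g, ?_, by simp⟩)
      rcases ((mulCayley_adj S _ _).1 hadj).2 with h | h
      · exact Or.inl h
      · exact Or.inr (by simpa using h)

theorem isHyperbolicGroup_iff : IsHyperbolicGroup G ↔ ∃ S : Set G, S.Finite ∧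
    Subgroup.closure S = ⊤ ∧ ∃ δ, SlimIntervals (mulCayley S).dist δ := by
  constructor
  · rintro ⟨S, hS, hc, δ, h⟩
    exact ⟨S, hS, hc, δ, h.slimIntervals (mulCayley_connected hc)⟩
  · rintro ⟨S, hS, hc, δ, h⟩
    exact ⟨S, hS, hc, _, h.hasSlimTriangles (mulCayley_connected hc)⟩

theorem IsHyperbolicGroup.of_mulEquiv (e : G ≃* H) (hG : IsHyperbolicGroup G) :
    IsHyperbolicGroup H := by
  obtain ⟨S, hS, hc, δ, h⟩ := isHyperbolicGroup_iff.1 hG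
  have hc' : Subgroup.closure (e '' S) = ⊤ := by
    have := MonoidHom.map_closure e.toMonoidHom S
    rw [hc, ← MonoidHom.range_eq_map, MonoidHom.range_eq_top.2 e.surjective] at this
    exact this.symm
  have hdist : ∀ x y, (mulCayley (e '' S)).dist x y = (mulCayley S).dist (e.symm x) (e.symm y) := by
    intro x y
    apply le_antisymm
    · have := (mulCayley_connected hc).dist_map_le (Y := mulCayley (e '' S)) ⟨e, fun {a b} hab => by
        rw [mulCayley_adj] at hab ⊢
        refine ⟨fun h => hab.1 (e.injective h), hab.2.imp (fun h => ?_) (fun h => ?_)⟩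
        · exact ⟨_, h, by simp⟩
        · exact ⟨_, h, by simp⟩⟩ (e.symm x) (e.symm y)
      simpa using this
    · exact (mulCayley_connected hc').dist_map_le (Y := mulCayley S) ⟨e.symm, fun {a b} hab => by
        rw [mulCayley_adj] at hab ⊢
        refine ⟨fun h => hab.1 (e.symm.injective h), hab.2.imp ?_ ?_⟩
        · rintro ⟨s, hs, h⟩; rw [← map_inv, ← map_mul, ← h]; simpa using hs
        · rintro ⟨s, hs, h⟩; rw [← map_inv, ← map_mul, ← h]; simpa using hs⟩ x y
  refine isHyperbolicGroup_iff.2 ⟨e '' S, hS.image e, hc', δ, fun x y z v hv => ?_⟩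
  obtain ⟨w, hw, hvw⟩ := h (e.symm x) (e.symm y) (e.symm z) (e.symm v) (by
    simpa only [IsBetween, hdist] using hv)
  exact ⟨e w, by simpa only [IsBetween, hdist, e.symm_apply_apply] using hw,
    by simpa only [hdist, e.symm_apply_apply] using hvw⟩

/-- The generating set of a hyperbolic group may be enlarged by any finite set. -/
theorem IsHyperbolicGroup.exists_superset (hG : IsHyperbolicGroup G) {T : Set G} (hT : T.Finite) :
    ∃ S : Set G, T ⊆ S ∧ S.Finite ∧ Subgroup.closure S = ⊤ ∧
      ∃ δ, SlimIntervals (mulCayley S).dist δ := by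
  obtain ⟨S, hS, hc, δ, h⟩ := isHyperbolicGroup_iff.1 hG
  have hc' : Subgroup.closure (S ∪ T) = ⊤ :=
    top_le_iff.1 (hc ▸ Subgroup.closure_mono Set.subset_union_left)
  refine ⟨S ∪ T, Set.subset_union_right, hS.union hT, hc', ?_⟩
  have hd := (mulCayley_connected hc).isGeodesicDist
  have hd' := (mulCayley_connected hc').isGeodesicDist
  have hle : ∀ x y, (mulCayley (S ∪ T)).dist x y ≤ (mulCayley S).dist x y := fun x y =>
    ((mulCayley_connected hc).preconnected x y).dist_anti (mulCayley_mono Set.subset_union_left)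
  obtain ⟨C, hC⟩ : ∃ C, ∀ s ∈ S ∪ T, (mulCayley S).dist 1 s ≤ C := by
    obtain ⟨C, hC⟩ := ((hS.union hT).image (fun s => (mulCayley S).dist 1 s)).bddAbove
    exact ⟨C, fun s hs => hC ⟨s, hs, rfl⟩⟩
  have hC' : ∀ x y, (mulCayley (S ∪ T)).dist x y ≤ 1 → (mulCayley S).dist x y ≤ C := by
    intro x y hxy
    have hx1 := mulCayley_dist_mul_left hc x 1 (x⁻¹ * y)
    have hy1 := mulCayley_dist_mul_left hc y 1 (y⁻¹ * x)
    simp only [mul_one, mul_inv_cancel_left] at hx1 hy1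
    rcases Nat.le_one_iff_eq_zero_or_eq_one.1 hxy with h0 | h0
    · rw [hd'.eq_of_zero h0, hd.self]; omega
    · rcases ((mulCayley_adj _ _ _).1 (dist_eq_one_iff_adj.1 h0)).2 with h1 | h1
      · rw [hx1]; exact hC _ h1
      · rw [hd.comm, hy1]; exact hC _ h1
  -- The guessed sets are the intervals of the old word metric: they are thin by `δ`, and points
  -- adjacent in the new graph have old distance at most `C`.
  refine hd'.slimIntervals_of_guess (h := δ + C + 1)
    (L := fun x y => {v | IsBetween (mulCayley S).dist x v y}) ?_ ?_ ?_
    (fun x y => hd.btw_left x y) (fun x y => hd.btw_right x y)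
  · intro x y z w hw
    obtain ⟨w', hw', hww'⟩ := h x y z w hw
    exact ⟨w', hw', by have := hle w w'; omega⟩
  · intro x y hxy w hw
    have h1 := hC' x y hxy
    have h2 := hle x w
    simp only [IsBetween, Set.mem_ofPred_eq] at hw
    omega
  · intro x y P Q hP hQ hPQ
    obtain ⟨w, w', hw, hw', hPw, hQw, h1⟩ := hd.interval_chain P Q hP hQ hPQ
    exact ⟨w, w', hw, hPw, hQw, by have := hle w w'; omega⟩

/-- A finite subgroup has a quasi-centre which it almost fixes. -/
theorem exists_almost_fixed (d : G → G → ℕ) (hd : ∀ g x y, d (g * x) (g * y) = d x y) (C : ℕ)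
    (K : Subgroup G) [Finite K]
    (hK : ∀ c, ∀ k ∈ K, C < d c (k * c) →
      ∃ m, ∀ z ∈ K, d m z < max (d c z) (d (k * c) z)) :
    ∃ c, ∀ k ∈ K, d c (k * c) ≤ C := by
  classical
  -- `r c` is the radius of the smallest ball about `c` containing the orbit `K` of `1`. At a centre
  -- of minimal radius no `k` can move `c` far, since otherwise the point `m` between `c` and `k *
  -- c` would have a smaller radius.
  have hr : ∀ c, ∃ r, (∀ z ∈ K, d c z ≤ r) ∧ ∃ z ∈ K, d c z = r := by
    intro c
    obtain ⟨z, hz⟩ := Finite.exists_max (fun z : K => d c z)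
    exact ⟨d c z, fun z' hz' => hz ⟨z', hz'⟩, z, z.2, rfl⟩
  choose r hr1 hr2 using hr
  obtain ⟨c, hc⟩ : ∃ c, ∀ m, r c ≤ r m := by
    have hex : ∃ n, ∃ c, r c = n := ⟨_, 1, rfl⟩
    obtain ⟨c, hc⟩ := Nat.find_spec hex
    exact ⟨c, fun m => hc ▸ Nat.find_min' hex ⟨m, rfl⟩⟩
  refine ⟨c, fun k hk => ?_⟩
  by_contra hcon
  obtain ⟨m, hm⟩ := hK c k hk (by omega)
  obtain ⟨z, hz, hmz⟩ := hr2 m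
  have h1 := hm z hz
  have h2 := hr1 c z hz
  have h3 : d (k * c) z ≤ r c := by
    have := hd k c (k⁻¹ * z)
    rw [mul_inv_cancel_left] at this
    rw [this]
    exact hr1 c _ (K.mul_mem (K.inv_mem hk) hz)
  have h4 := hc m
  have := max_le h2 h3
  omega

/-- Up to conjugation, the finite subgroups of a hyperbolic group lie in a finite subset. -/
theorem IsHyperbolicGroup.exists_finite_conj (hG : IsHyperbolicGroup G) :
    ∃ T : Set G, T.Finite ∧ ∀ K : Subgroup G, Finite K → ∃ c, ∀ k ∈ K, c⁻¹ * k * c ∈ T := by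
  obtain ⟨S, hS, hc, δ, h⟩ := isHyperbolicGroup_iff.1 hG
  have hd := (mulCayley_connected hc).isGeodesicDist
  refine ⟨_, mulCayley_ball_finite hS hc (4 * δ + 2), fun K hK => ?_⟩
  obtain ⟨c, hcK⟩ := exists_almost_fixed (mulCayley S).dist (mulCayley_dist_mul_left hc)
    (4 * δ + 2) K (by
      intro c k hk hlt
      -- Both ends are more than `2 * δ` away from `m`. A point within `δ` of `m` on a geodesic from
      -- an end to `z` is therefore more than `δ` from that end, which makes `m` strictly closer to
      -- `z` than this end.
      obtain ⟨m, h1, h2⟩ := hd.split c (k * c) (2 * δ + 1) (by omega)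
      refine ⟨m, fun z hz => ?_⟩
      obtain ⟨w, hw, hmw⟩ := h c (k * c) z m h2
      have e1 := hd.triangle m w z
      have e2 := hd.triangle c w m
      have e3 := hd.triangle m w (k * c)
      have e4 := hd.comm w m
      have e5 := hd.comm w z
      have e6 := hd.comm (k * c) z
      have e7 := hd.comm w (k * c)
      rw [lt_max_iff]
      simp only [IsBetween] at hw
      omega)
  refine ⟨c, fun k hk => ?_⟩
  have := hcK k hk
  rw [← mulCayley_dist_mul_left hc c⁻¹] at this
  simpa [mul_assoc] using this

end Cayley

/-! ### The action of an HNN extension on its tree -/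

namespace HNNExtension

open NormalWord Pointwise

variable {G : Type*} [Group G] {A B : Subgroup G} {φ : A ≃* B}

variable (A B) in
/-- A choice of transversals. -/
noncomputable def stdTransversal : TransversalPair G A B :=
  Classical.choice (TransversalPair.nonempty G A B)

/-- The normal form of an element of an HNN extension. -/
noncomputable def nf (w : HNNExtension G A B φ) : NormalWord (stdTransversal A B) :=
  NormalWord.equiv φ _ w

/-- The number of stable letters in a reduced form. -/
noncomputable def len (w : HNNExtension G A B φ) : ℕ := (nf w).toList.length

variable (A B) in
/-- The edge `h • toSubgroup (-u)` through which the reduced words starting with `h * t ^ u` leave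
the base group. -/
def edge (u : ℤˣ) (h : G) : Option (ℤˣ × Set G) :=
  some (u, h • (toSubgroup A B (-u) : Set G))

/-- The first edge of a reduced form, `none` for the elements of the base group. -/
noncomputable def gate (w : HNNExtension G A B φ) : Option (ℤˣ × Set G) :=
  (nf w).toList.head?.bind fun p => edge A B p.1 (nf w).head

theorem edge_eq_edge {u v : ℤˣ} {g h : G} :
    edge A B u g = edge A B v h ↔ u = v ∧ g⁻¹ * h ∈ toSubgroup A B (-u) := by
  simp only [edge, Option.some.injEq, Prod.mk.injEq]
  constructor
  · rintro ⟨rfl, h⟩; exact ⟨rfl, (leftCoset_eq_iff _).1 h⟩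
  · rintro ⟨rfl, h⟩; exact ⟨rfl, (leftCoset_eq_iff _).2 h⟩

theorem edge_ne_none (u : ℤˣ) (g : G) : edge A B u g ≠ none := Option.some_ne_none _

theorem nf_of_mul (g : G) (w : HNNExtension G A B φ) : nf (of g * w) = g • nf w := by
  change (of g * w) • (empty : NormalWord (stdTransversal A B)) =
    g • (w • (empty : NormalWord (stdTransversal A B)))
  rw [mul_smul, of_smul_eq_smul]

theorem nf_t_mul (u : ℤˣ) (w : HNNExtension G A B φ) :
    nf (t ^ (u : ℤ) * w) = unitsSMul φ u (nf w) := by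
  change (t ^ (u : ℤ) * w) • empty = unitsSMul φ u (w • empty)
  rw [mul_smul, t_pow_smul_eq_unitsSMul]

theorem prod_nf (w : HNNExtension G A B φ) : (nf w).prod φ = w :=
  (NormalWord.equiv φ (stdTransversal A B)).symm_apply_apply w

theorem len_of_mul (g : G) (w : HNNExtension G A B φ) : len (of g * w) = len w := by
  simp [len, nf_of_mul]

theorem gate_of_mul (g : G) (w : HNNExtension G A B φ) :
    gate (of g * w) = (gate w).map fun e => (e.1, g • e.2) := by
  simp only [gate, nf_of_mul, group_smul_toList, group_smul_head]
  cases (nf w).toList.head? <;> simp [edge, mul_smul]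

theorem gate_eq_none_iff_len (w : HNNExtension G A B φ) : gate w = none ↔ len w = 0 := by
  simp only [gate, len]
  cases h : (nf w).toList <;> simp [edge]

theorem len_eq_zero_iff (w : HNNExtension G A B φ) : len w = 0 ↔ ∃ g, w = of g := by
  constructor
  · intro h
    refine ⟨(nf w).head, ?_⟩
    conv_lhs => rw [← prod_nf w]
    simp [ReducedWord.prod, List.eq_nil_of_length_eq_zero h]
  · rintro ⟨g, rfl⟩
    have : nf (of g : HNNExtension G A B φ) = g • empty := by
      change (of g : HNNExtension G A B φ) • empty = _
      rw [of_smul_eq_smul]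
    simp [len, this]

theorem gate_eq_none_iff (w : HNNExtension G A B φ) : gate w = none ↔ ∃ g, w = of g :=
  (gate_eq_none_iff_len w).trans (len_eq_zero_iff w)

@[simp]
theorem gate_of (g : G) : gate (of g : HNNExtension G A B φ) = none :=
  (gate_eq_none_iff _).2 ⟨g, rfl⟩

@[simp]
theorem len_of (g : G) : len (of g : HNNExtension G A B φ) = 0 :=
  (len_eq_zero_iff _).2 ⟨g, rfl⟩

@[simp]
theorem gate_one : gate (1 : HNNExtension G A B φ) = none := by
  rw [← map_one of, gate_of]

theorem cancels_iff (u : ℤˣ) (w : HNNExtension G A B φ) :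
    Cancels u (nf w) ↔ gate w = edge A B (-u) 1 := by
  simp only [Cancels, gate]
  cases h : (nf w).toList with
  | nil => simp [edge]
  | cons p l =>
    simp only [List.head?_cons, Option.map_some, Option.some.injEq, Option.bind_some,
      edge_eq_edge, mul_one, inv_mem_iff]
    constructor
    · rintro ⟨h1, h2⟩; refine ⟨h2, ?_⟩; rw [h2, neg_neg]; exact h1
    · rintro ⟨h2, h1⟩; rw [h2, neg_neg] at h1; exact ⟨h1, h2⟩

theorem len_t_mul {u : ℤˣ} {w : HNNExtension G A B φ} (h : gate w ≠ edge A B (-u) 1) :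
    len (t ^ (u : ℤ) * w) = len w + 1 := by
  rw [len, nf_t_mul, unitsSMul, dif_neg (mt (cancels_iff u w).1 h)]
  simp [NormalWord.cons, len]

theorem gate_t_mul {u : ℤˣ} {w : HNNExtension G A B φ} (h : gate w ≠ edge A B (-u) 1) :
    gate (t ^ (u : ℤ) * w) = edge A B u 1 := by
  rw [gate, nf_t_mul, unitsSMul, dif_neg (mt (cancels_iff u w).1 h)]
  simp only [NormalWord.cons, List.head?_cons, Option.bind_some]
  rw [edge_eq_edge]
  simp

theorem len_t_mul_of_eq {u : ℤˣ} {w : HNNExtension G A B φ} (h : gate w = edge A B (-u) 1) :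
    len (t ^ (u : ℤ) * w) + 1 = len w := by
  have hc := (unitsSMul_cancels_iff φ (-u) (unitsSMul φ u (nf w)))
  have h1 : gate (t ^ (u : ℤ) * w) ≠ edge A B (- -u) 1 := by
    intro h2
    rw [← cancels_iff, nf_t_mul, ← neg_neg (-u), neg_neg u] at h2
    have := (unitsSMul_cancels_iff φ u (nf w)).not
    rw [← cancels_iff] at h
    have h3 : Cancels (- -u) (unitsSMul φ (-u) (unitsSMul φ u (nf w))) := by
      rw [unitsSMul_neg, neg_neg]; exact h
    rw [hc] at h3
    exact h3 (by simpa using h2)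
  have := len_t_mul (u := -u) h1
  rw [← mul_assoc, ← zpow_add] at this
  simp only [Units.val_neg, neg_add_cancel, zpow_zero, one_mul] at this
  exact this.symm

theorem gate_of_mul_edge {w : HNNExtension G A B φ} (g : G) {u : ℤˣ} {h : G} :
    gate w = edge A B u h ↔ gate (of g * w) = edge A B u (g * h) := by
  rw [gate_of_mul]
  constructor
  · intro hw; rw [hw]; simp [edge, mul_smul]
  · intro hw
    cases hg : gate w with
    | none => rw [hg] at hw; simp [edge] at hw
    | some e =>
      rw [hg] at hw
      simp only [edge, Option.map_some, Option.some.injEq, Prod.mk.injEq, mul_smul,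
        smul_left_cancel_iff] at hw
      obtain ⟨h1, h2⟩ := hw
      subst h1
      rw [edge, ← h2]

/-- Splitting off the first stable letter of a reduced form. -/
theorem exists_eq_of_mul_t_mul {w : HNNExtension G A B φ} (hw : gate w ≠ none) :
    ∃ g u w', w = of g * (t ^ ((u : ℤˣ) : ℤ) * w') ∧ gate w' ≠ edge A B (-u) 1 ∧
      gate w = edge A B u g ∧ len w = len w' + 1 := by
  cases h : (nf w).toList with
  | nil => simp [gate, h] at hw
  | cons p l =>
    set g := (nf w).head
    have hg : gate w = edge A B p.1 g := by simp [gate, h, g]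
    set w' := t ^ ((-p.1 : ℤˣ) : ℤ) * (of g⁻¹ * w) with hw'
    have hgate : gate (of g⁻¹ * w) = edge A B (- -p.1) 1 := by
      have := (gate_of_mul_edge g⁻¹).1 hg
      simpa using this
    have hlen := len_t_mul_of_eq (u := -p.1) hgate
    rw [← hw', len_of_mul] at hlen
    have hww : w = of g * (t ^ (p.1 : ℤ) * w') := by
      rw [hw', ← mul_assoc (t ^ _), ← zpow_add]; simp
    refine ⟨g, p.1, w', hww, fun hc => ?_, hg, hlen.symm⟩
    have h1 := len_t_mul_of_eq hc
    have h2 : len w = len (t ^ (p.1 : ℤ) * w') := by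
      conv_lhs => rw [hww]
      rw [len_of_mul]
    omega

theorem gate_t_zpow_mul_of (u : ℤˣ) (g : G) :
    gate (t ^ (u : ℤ) * of g : HNNExtension G A B φ) = edge A B u 1 :=
  gate_t_mul (by rw [gate_of]; exact (edge_ne_none _ _).symm)

theorem len_t_zpow_mul_of (u : ℤˣ) (g : G) :
    len (t ^ (u : ℤ) * of g : HNNExtension G A B φ) = 1 := by
  rw [len_t_mul (by rw [gate_of]; exact (edge_ne_none _ _).symm), len_of]

/-- In the tree, the gate is the first edge on the way from the base vertex. If the paths to the
translates of that vertex by `a⁻¹` and `y` start with different edges, their union is a geodesic;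
translated by `a` it is the path belonging to `a * y`. The statement about `a⁻¹` must be proved
simultaneously, because the induction identifies `gate a⁻¹` by applying the statement to the inverse
of the shorter element. -/
theorem mul_aux (n : ℕ) : ∀ a : HNNExtension G A B φ, len a = n → len a⁻¹ = len a ∧
    (gate a ≠ none → ∀ y, gate a⁻¹ ≠ gate y → gate (a * y) = gate a ∧
      len (a * y) = len a + len y) := by
  induction n using Nat.strong_induction_on with
  | _ n ih =>
  intro a ha
  by_cases hna : gate a = none
  · obtain ⟨g, rfl⟩ := (gate_eq_none_iff a).1 hna
    exact ⟨by rw [← map_inv, len_of, len_of], fun h => absurd hna h⟩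
  obtain ⟨g, u, a', rfl, h1, h2, h3⟩ := exists_eq_of_mul_t_mul hna
  have hinv : (of g * (t ^ (u : ℤ) * a'))⁻¹ = a'⁻¹ * (t ^ ((-u : ℤˣ) : ℤ) * of g⁻¹) := by
    simp [mul_assoc]
  have key : len (of g * (t ^ (u : ℤ) * a'))⁻¹ = len (of g * (t ^ (u : ℤ) * a')) ∧
      ∀ y, gate (of g * (t ^ (u : ℤ) * a'))⁻¹ ≠ gate y →
        gate (a' * y) ≠ edge A B (-u) 1 ∧ len (a' * y) = len a' + len y := by
    by_cases hna' : gate a' = none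
    · obtain ⟨g', rfl⟩ := (gate_eq_none_iff a').1 hna'
      rw [hinv, h3, ← map_inv, len_of_mul, len_t_zpow_mul_of, len_of]
      refine ⟨rfl, fun y hy => ⟨fun hc => hy ?_, by rw [len_of_mul]; omega⟩⟩
      have h4 := (gate_of_mul_edge g'⁻¹).1 hc
      have h5 := (gate_of_mul_edge g'⁻¹).1
        (gate_t_zpow_mul_of (φ := φ) (-u) g⁻¹)
      rw [← mul_assoc, ← map_mul, inv_mul_cancel, map_one, one_mul] at h4
      rw [h4, h5]
    · obtain ⟨i1, i2⟩ := ih _ (by omega) a' rfl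
      obtain ⟨i3, i4⟩ := ih (len a') (by omega) a'⁻¹ i1
      have hna'' : gate a'⁻¹ ≠ none := by
        rw [Ne, gate_eq_none_iff_len, i1, ← gate_eq_none_iff_len]; exact hna'
      obtain ⟨i5, i6⟩ := i4 hna'' (t ^ ((-u : ℤˣ) : ℤ) * of g⁻¹)
        (by rw [inv_inv, gate_t_zpow_mul_of]; exact h1)
      rw [hinv, i6, h3, i1, len_t_zpow_mul_of, i5]
      refine ⟨rfl, fun y hy => ?_⟩
      obtain ⟨i7, i8⟩ := i2 hna' y hy
      exact ⟨i7 ▸ h1, i8⟩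
  refine ⟨key.1, fun _ y hy => ?_⟩
  obtain ⟨k1, k2⟩ := key.2 y hy
  rw [mul_assoc, mul_assoc, h2, len_of_mul, len_of_mul, len_t_mul k1, len_t_mul h1, k2]
  refine ⟨?_, by omega⟩
  have := (gate_of_mul_edge g).1 (gate_t_mul k1)
  rwa [mul_one] at this

theorem len_inv (a : HNNExtension G A B φ) : len a⁻¹ = len a := (mul_aux _ a rfl).1

theorem gate_inv_eq_none_iff (a : HNNExtension G A B φ) : gate a⁻¹ = none ↔ gate a = none := by
  rw [gate_eq_none_iff_len, gate_eq_none_iff_len, len_inv]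

theorem gate_mul {a y : HNNExtension G A B φ} (ha : gate a ≠ none) (h : gate a⁻¹ ≠ gate y) :
    gate (a * y) = gate a :=
  ((mul_aux _ a rfl).2 ha y h).1

theorem len_mul {a y : HNNExtension G A B φ} (ha : gate a ≠ none) (h : gate a⁻¹ ≠ gate y) :
    len (a * y) = len a + len y :=
  ((mul_aux _ a rfl).2 ha y h).2

theorem gate_mul_of {w : HNNExtension G A B φ} (hw : gate w ≠ none) (g : G) :
    gate (w * of g) = gate w :=
  gate_mul hw (by rw [gate_of]; exact mt (gate_inv_eq_none_iff w).1 hw)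

theorem gate_of_mul_t (p : G) (v : ℤˣ) :
    gate (of p * t ^ (v : ℤ) : HNNExtension G A B φ) = edge A B v p := by
  have := (gate_of_mul_edge p).1 (gate_t_zpow_mul_of (φ := φ) v 1)
  simpa using this

theorem gate_t_zpow (v : ℤˣ) : gate (t ^ (v : ℤ) : HNNExtension G A B φ) = edge A B v 1 := by
  simpa using gate_of_mul_t (φ := φ) 1 v

/-- Right multiplication by a stable letter preserves the gate unless it leads to the base. -/
theorem gate_mul_t {w : HNNExtension G A B φ} (hw : gate w ≠ none) (u : ℤˣ) :
    gate (w * t ^ (u : ℤ)) = gate w ∨ ∃ p, w * t ^ (u : ℤ) = of p := by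
  by_cases h : gate w⁻¹ = gate (t ^ (u : ℤ) : HNNExtension G A B φ)
  · set w' := w * t ^ (u : ℤ) with hw'
    have hww : w = w' * t ^ ((-u : ℤˣ) : ℤ) := by simp [hw']
    by_cases hn : gate w' = none
    · exact Or.inr ((gate_eq_none_iff _).1 hn)
    · left
      have hlen : len w' + 1 = len w := by
        rw [← len_inv w', ← len_inv w]
        have : w'⁻¹ = t ^ ((-u : ℤˣ) : ℤ) * w⁻¹ := by simp [hw']
        rw [this]
        exact len_t_mul_of_eq (by rw [h, gate_t_zpow, neg_neg])
      rw [hww]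
      refine (gate_mul hn fun hc => ?_).symm
      have : len (t ^ (u : ℤ) * w'⁻¹) + 1 = len w'⁻¹ :=
        len_t_mul_of_eq (by rw [hc, gate_t_zpow])
      have h2 : w⁻¹ = t ^ (u : ℤ) * w'⁻¹ := by rw [hww]; simp
      rw [← h2, len_inv, len_inv] at this
      omega
  · exact Or.inl (gate_mul hw h)

end HNNExtension

namespace HNNExtension

open NormalWord Pointwise SimpleGraph

variable {G : Type*} [Group G] {A B : Subgroup G} {φ : A ≃* B}

/-! ### HNN extensions of hyperbolic groups over finite subgroups -/

variable (φ) in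
/-- The generators of an HNN extension obtained from generators of the base group. -/
def gens (S : Set G) : Set (HNNExtension G A B φ) := insert t (of '' S)

variable (φ) in
/-- The word metric of an HNN extension. -/
noncomputable def wdist (S : Set G) : HNNExtension G A B φ → HNNExtension G A B φ → ℕ :=
  (mulCayley (gens φ S)).dist

theorem closure_gens {S : Set G} (hS : Subgroup.closure S = ⊤) :
    Subgroup.closure (gens φ S) = ⊤ := by
  refine (Subgroup.eq_top_iff' _).2 fun x => ?_
  induction x using HNNExtension.induction_on with
  | of g =>
    have h1 : (Subgroup.closure S).map of ≤ Subgroup.closure (gens φ S) := by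
      rw [MonoidHom.map_closure]
      exact Subgroup.closure_mono (Set.subset_insert _ _)
    exact h1 ⟨g, by rw [hS]; trivial, rfl⟩
  | t => exact Subgroup.subset_closure (Set.mem_insert _ _)
  | mul x y hx hy => exact mul_mem hx hy
  | inv x hx => exact inv_mem hx

variable {S : Set G}

theorem isGeodesicDist_wdist (hS : Subgroup.closure S = ⊤) : IsGeodesicDist (wdist φ S) :=
  (mulCayley_connected (closure_gens hS)).isGeodesicDist

theorem wdist_step {x y : HNNExtension G A B φ} (h : wdist φ S x y = 1) :
    (∃ g, (g ∈ S ∨ g⁻¹ ∈ S) ∧ y = x * of g) ∨ ∃ u : ℤˣ, y = x * t ^ (u : ℤ) := by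
  have hadj := ((mulCayley_adj _ _ _).1 (dist_eq_one_iff_adj.1 h)).2
  rcases hadj with (h | ⟨g, hg, h⟩) | (h | ⟨g, hg, h⟩)
  · exact Or.inr ⟨1, by simp [← h]⟩
  · exact Or.inl ⟨g, Or.inl hg, by simp [h]⟩
  · exact Or.inr ⟨-1, by simp [← h]⟩
  · exact Or.inl ⟨g⁻¹, Or.inr (by simpa using hg), by simp [h]⟩

theorem wdist_mul_of_le (x : HNNExtension G A B φ) {g : G} (hg : g ∈ S ∨ g⁻¹ ∈ S) :
    wdist φ S x (x * of g) ≤ 1 :=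
  mulCayley_dist_le_one x (hg.imp (fun h => Or.inr ⟨g, h, rfl⟩)
    fun h => Or.inr ⟨g⁻¹, h, map_inv _ _⟩)

theorem wdist_mul_t_le (x : HNNExtension G A B φ) (u : ℤˣ) :
    wdist φ S x (x * t ^ (u : ℤ)) ≤ 1 := by
  refine mulCayley_dist_le_one x ?_
  rcases Int.units_eq_one_or u with rfl | rfl <;> simp [gens]

/-- Geodesics to points behind another gate pass through the gate. -/
theorem exists_door (hS : Subgroup.closure S = ⊤) (n : ℕ) :
    ∀ x y : HNNExtension G A B φ, wdist φ S x y = n → gate x ≠ none → gate x ≠ gate y →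
    ∃ v p, gate x = edge A B v p ∧
      wdist φ S x (of p * t ^ (v : ℤ)) + 1 + wdist φ S (of p) y = wdist φ S x y := by
  have hd := isGeodesicDist_wdist (φ := φ) hS
  induction n with
  | zero =>
    intro x y hn _ hxy
    exact absurd (congrArg gate (hd.eq_of_zero hn)) hxy
  | succ n ih =>
    intro x y hn hx hxy
    obtain ⟨x₁, h1, h2⟩ := hd.split x y 1 (by omega)
    have hle : ∀ (v : ℤˣ) (p : G), wdist φ S x y ≤
        wdist φ S x (of p * t ^ (v : ℤ)) + 1 + wdist φ S (of p) y := by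
      intro v p
      have e1 := hd.triangle x (of p * t ^ (v : ℤ)) y
      have e2 := hd.triangle (of p * t ^ (v : ℤ)) (of p) y
      have e3 := wdist_mul_t_le (S := S) (of p : HNNExtension G A B φ) v
      rw [hd.comm] at e3
      omega
    have key : gate x₁ = gate x → ∃ v p, gate x = edge A B v p ∧
        wdist φ S x (of p * t ^ (v : ℤ)) + 1 + wdist φ S (of p) y = wdist φ S x y := by
      intro hg
      obtain ⟨v, p, h3, h4⟩ := ih x₁ y (by omega) (hg ▸ hx) (hg ▸ hxy)
      refine ⟨v, p, hg ▸ h3, le_antisymm ?_ (hle v p)⟩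
      have := hd.triangle x x₁ (of p * t ^ (v : ℤ))
      omega
    -- The gate changes along the geodesic only when a stable letter leads into the base group, and
    -- that step crosses the edge of the gate.
    rcases wdist_step h1 with ⟨g, -, rfl⟩ | ⟨u, hu⟩
    · exact key (gate_mul_of hx g)
    · rcases gate_mul_t hx u with h | ⟨p, hp⟩
      · exact key (hu ▸ h)
      · have hxp : x = of p * t ^ ((-u : ℤˣ) : ℤ) := by rw [← hp]; simp
        refine ⟨-u, p, by rw [hxp, gate_of_mul_t], le_antisymm ?_ (hle _ _)⟩
        rw [← hxp, hd.self, ← hp, ← hu]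
        omega

/-- A path that leaves the base group has to return through the same edge. The two points where it
leaves and returns differ by an element of `A` or `B`, hence by a generator, so one step replaces
the excursion. -/
theorem wdist_of_of (hS : Subgroup.closure S = ⊤) (hA : (A : Set G) ⊆ S) (hB : (B : Set G) ⊆ S)
    (g g' : G) : wdist φ S (of g) (of g') = (mulCayley S).dist g g' := by
  have hd := isGeodesicDist_wdist (φ := φ) hS
  have hd' := (mulCayley_connected hS).isGeodesicDist
  apply le_antisymm
  · refine (mulCayley_connected hS).dist_map_le (Y := mulCayley (gens φ S)) ⟨of, fun {a b} h => ?_⟩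
      g g'
    rw [mulCayley_adj] at h ⊢
    refine ⟨fun h' => h.1 (of_injective φ h'), h.2.imp (fun h => ?_) (fun h => ?_)⟩
    · exact Or.inr ⟨_, h, by simp⟩
    · exact Or.inr ⟨_, h, by simp⟩
  generalize hn : wdist φ S (of g) (of g') = n
  induction n using Nat.strong_induction_on generalizing g g' with
  | _ n ih =>
  rcases Nat.eq_zero_or_pos n with rfl | hpos
  · rw [of_injective φ (hd.eq_of_zero hn), hd'.self]
  obtain ⟨x₁, h1, h2⟩ := hd.split (of g) (of g') 1 (by omega)
  rcases wdist_step h1 with ⟨s, hs, rfl⟩ | ⟨u, rfl⟩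
  · rw [← map_mul] at *
    have := ih _ (by omega) (g * s) g' rfl
    have := hd'.triangle g (g * s) g'
    have := mulCayley_dist_le_one g hs
    omega
  · obtain ⟨v, p, h3, h4⟩ := exists_door hS _ (of g * t ^ (u : ℤ) : HNNExtension G A B φ) (of g')
      rfl (by rw [gate_of_mul_t]; exact edge_ne_none _ _)
      (by rw [gate_of_mul_t, gate_of]; exact edge_ne_none _ _)
    rw [gate_of_mul_t, edge_eq_edge] at h3
    have h5 := ih _ (by omega) p g' rfl
    have h6 : (mulCayley S).dist g (g * (g⁻¹ * p)) ≤ 1 := by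
      refine mulCayley_dist_le_one g (Or.inl ?_)
      rcases Int.units_eq_one_or u with rfl | rfl
      · exact hB h3.2
      · exact hA h3.2
    rw [mul_inv_cancel_left] at h6
    have := hd'.triangle g p g'
    omega

/-- The vertices through which geodesics from the base group to `x` leave the base group. -/
def IsDoor (x : HNNExtension G A B φ) (p : G) : Prop :=
  x = of p ∨ ∃ v, gate x = edge A B v p

theorem exists_isDoor (x : HNNExtension G A B φ) : ∃ p, IsDoor x p := by
  by_cases h : gate x = none
  · obtain ⟨g, hg⟩ := (gate_eq_none_iff x).1 h
    exact ⟨g, Or.inl hg⟩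
  · obtain ⟨g, u, _, _, _, h', _⟩ := exists_eq_of_mul_t_mul h
    exact ⟨g, Or.inr ⟨u, h'⟩⟩

theorem dist_edge_le (hA : (A : Set G) ⊆ S) (hB : (B : Set G) ⊆ S) {v v' : ℤˣ} {p q : G}
    (h : edge A B v p = edge A B v' q) : (mulCayley S).dist p q ≤ 1 := by
  obtain ⟨rfl, h'⟩ := edge_eq_edge.1 h
  have h6 : (mulCayley S).dist p (p * (p⁻¹ * q)) ≤ 1 := by
    refine mulCayley_dist_le_one p (Or.inl ?_)
    rcases Int.units_eq_one_or v with rfl | rfl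
    · exact hB h'
    · exact hA h'
  rwa [mul_inv_cancel_left] at h6

theorem wdist_edge_le (hA : (A : Set G) ⊆ S) (hB : (B : Set G) ⊆ S) {v v' : ℤˣ} {p q : G}
    (h : edge A B v p = edge A B v' q) :
    wdist φ S (of p * t ^ (v : ℤ)) (of q * t ^ (v' : ℤ)) ≤ 1 := by
  obtain ⟨rfl, hpq⟩ := edge_eq_edge.1 h
  obtain ⟨h', rfl⟩ : ∃ h', q = p * h' := ⟨p⁻¹ * q, by simp⟩
  rw [inv_mul_cancel_left] at hpq
  rcases Int.units_eq_one_or v with rfl | rfl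
  · have := of_mul_t (φ := φ) ⟨h', hpq⟩
    simp only [Units.val_one, zpow_one, map_mul, mul_assoc]
    dsimp only at this
    rw [this, ← mul_assoc]
    exact wdist_mul_of_le _ (Or.inl (hA (SetLike.coe_mem _)))
  · have := of_mul_inv_t (φ := φ) ⟨h', hpq⟩
    simp only [Units.val_neg, Units.val_one, zpow_neg, zpow_one, map_mul, mul_assoc]
    dsimp only at this
    rw [this, ← mul_assoc]
    exact wdist_mul_of_le _ (Or.inl (hB (SetLike.coe_mem _)))

/-- With equal gates the geodesic would cross the same edge twice, at a cost of at least two,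
whereas the points at the far side of that edge are at distance at most one. -/
theorem gate_ne_of_isBetween (hS : Subgroup.closure S = ⊤) (hA : (A : Set G) ⊆ S)
    (hB : (B : Set G) ⊆ S) {x y : HNNExtension G A B φ} {c : G}
    (h : IsBetween (wdist φ S) x (of c) y) (hx : gate x ≠ none) : gate x ≠ gate y := by
  intro hxy
  have hd := isGeodesicDist_wdist (φ := φ) hS
  obtain ⟨v, p, h1, h2⟩ := exists_door hS _ x (of c) rfl hx (by rwa [gate_of])
  obtain ⟨w, q, h3, h4⟩ := exists_door hS _ y (of c) rfl (hxy ▸ hx) (by rwa [gate_of, ← hxy])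
  have h5 := wdist_edge_le (φ := φ) hA hB (h1.symm.trans (hxy.trans h3))
  have h6 := hd.triangle x (of p * t ^ (v : ℤ)) y
  have h7 := hd.triangle (of p * t ^ (v : ℤ)) (of q * t ^ (w : ℤ)) y
  have h8 := hd.comm y (of q * t ^ (w : ℤ))
  have h9 := hd.comm y (of c)
  simp only [IsBetween] at h
  omega

theorem exists_isDoor_isBetween (hS : Subgroup.closure S = ⊤) {x y : HNNExtension G A B φ}
    (h : gate x ≠ none → gate x ≠ gate y) :
    ∃ p, IsDoor x p ∧ IsBetween (wdist φ S) x (of p) y := by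
  have hd := isGeodesicDist_wdist (φ := φ) hS
  by_cases hx : gate x = none
  · obtain ⟨g, rfl⟩ := (gate_eq_none_iff x).1 hx
    exact ⟨g, Or.inl rfl, hd.btw_left _ _⟩
  · obtain ⟨v, p, h1, h2⟩ := exists_door hS _ x y rfl hx (h hx)
    refine ⟨p, Or.inr ⟨v, h1⟩, ?_⟩
    have h3 := hd.triangle x (of p) y
    have h4 := hd.triangle x (of p * t ^ (v : ℤ)) (of p)
    have e3 := wdist_mul_t_le (S := S) (of p : HNNExtension G A B φ) v
    rw [hd.comm] at e3
    simp only [IsBetween]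
    omega

theorem dist_le_of_isDoor (hS : Subgroup.closure S = ⊤) (hA : (A : Set G) ⊆ S)
    (hB : (B : Set G) ⊆ S)
    {x y : HNNExtension G A B φ} {p q : G} (hp : IsDoor x p) (hq : IsDoor y q)
    (hx : gate x = gate y) (hxy : x = y ∨ gate x ≠ none) : (mulCayley S).dist p q ≤ 1 := by
  have hd := (mulCayley_connected hS).isGeodesicDist
  rcases hp with rfl | ⟨v, hv⟩
  · rw [gate_of] at hx hxy
    rcases hxy with rfl | h
    · rcases hq with h | ⟨v, hv⟩
      · rw [of_injective φ h, hd.self]; omega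
      · rw [gate_of] at hv; exact absurd hv.symm (edge_ne_none _ _)
    · exact absurd rfl h
  · rcases hq with rfl | ⟨w, hw⟩
    · rw [gate_of] at hx; exact absurd (hv.symm.trans hx) (edge_ne_none _ _)
    · exact dist_edge_le hA hB (hv.symm.trans (hx.trans hw))

/-- By left invariance the point on the side may be taken to be `1`, so that it lies in the base
group. Replacing the vertices by their doors gives a triangle in the base, where slimness is known.
It remains to return from intervals between doors to intervals between the original vertices. -/
theorem slimIntervals_wdist (hS : Subgroup.closure S = ⊤) (hA : (A : Set G) ⊆ S)
    (hB : (B : Set G) ⊆ S) {δ : ℕ} (hδ : SlimIntervals (mulCayley S).dist δ) :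
    SlimIntervals (wdist φ S) (3 * δ + 2) := by
  have hd := isGeodesicDist_wdist (φ := φ) hS
  have hd' := (mulCayley_connected hS).isGeodesicDist
  have hdd : ∀ g g' : G, wdist φ S (of g) (of g') = (mulCayley S).dist g g' :=
    wdist_of_of hS hA hB
  -- points of the base group between two doors are close to intervals
  have K : ∀ (x z : HNNExtension G A B φ) (p r w : G), IsDoor x p → IsDoor z r →
      (gate x ≠ none → gate x ≠ gate z) → IsBetween (mulCayley S).dist p w r →
      ∃ w', IsBetween (wdist φ S) x w' z ∧ wdist φ S (of w) w' ≤ 2 * δ + 1 := by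
    intro x z p r w hp hr hxz hw
    obtain ⟨p', hp', hp1⟩ := exists_isDoor_isBetween (S := S) hS hxz
    have hzp : gate z ≠ none → gate z ≠ gate (of p' : HNNExtension G A B φ) := fun h => by
      rwa [gate_of]
    obtain ⟨r', hr', hr1⟩ := exists_isDoor_isBetween hS hzp
    have hpp := dist_le_of_isDoor hS hA hB hp hp' rfl (Or.inl rfl)
    have hrr := dist_le_of_isDoor hS hA hB hr hr' rfl (Or.inl rfl)
    have hinc : ∀ u, IsBetween (mulCayley S).dist p' u r' → IsBetween (wdist φ S) x (of u) z := by
      intro u hu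
      have : IsBetween (wdist φ S) (of p') (of u) (of r') := by
        simpa only [IsBetween, hdd] using hu
      exact hd.btw_trans_right (hd.btw_trans_left this (hd.btw_symm hr1)) hp1
    obtain ⟨w₁, hw₁, hww₁⟩ := hδ p r r' w hw
    have : ∃ w₂, IsBetween (mulCayley S).dist p' w₂ r' ∧
        (mulCayley S).dist w₁ w₂ ≤ δ + 1 := by
      rcases hw₁ with hw₁ | hw₁
      · obtain ⟨w₂, hw₂, hww₂⟩ := hδ p r' p' w₁ hw₁
        rcases hw₂ with hw₂ | hw₂
        · refine ⟨p', hd'.btw_left _ _, ?_⟩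
          have := hd'.triangle w₁ w₂ p'
          simp only [IsBetween] at hw₂
          omega
        · exact ⟨w₂, hw₂, by omega⟩
      · refine ⟨r', hd'.btw_right _ _, ?_⟩
        have := hd'.comm w₁ r'
        have := hd'.comm r r'
        simp only [IsBetween] at hw₁
        omega
    obtain ⟨w₂, hw₂, hww₂⟩ := this
    refine ⟨of w₂, hinc _ hw₂, ?_⟩
    rw [hdd]
    have := hd'.triangle w w₁ w₂
    omega
  -- half of the argument, for a point close to one of the two other sides
  have M : ∀ (x y z : HNNExtension G A B φ) (p q r w : G), IsDoor x p → IsDoor y q → IsDoor z r →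
      (gate x ≠ none → gate x ≠ gate y) → IsBetween (mulCayley S).dist p w r →
      ∃ w', (IsBetween (wdist φ S) x w' z ∨ IsBetween (wdist φ S) z w' y) ∧
        wdist φ S (of w) w' ≤ 2 * δ + 2 := by
    intro x y z p q r w hp hq hr hxy hw
    by_cases hxz : gate x ≠ none → gate x ≠ gate z
    · obtain ⟨w', h1, h2⟩ := K x z p r w hp hr hxz hw
      exact ⟨w', Or.inl h1, by omega⟩
    -- If `x` and `z` lie behind the same gate, the side between their doors has length at most one.
    -- Then `r` replaces `w`, and it is close to the side from `z` to `y`.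
    · push Not at hxz
      have h1 := dist_le_of_isDoor hS hA hB hp hr hxz.2 (Or.inr hxz.1)
      obtain ⟨w', h2, h3⟩ := K z y r q r hr hq (fun _ => hxz.2 ▸ hxy hxz.1) (hd'.btw_left _ _)
      refine ⟨w', Or.inr h2, ?_⟩
      have := hd.triangle (of w) (of r) w'
      rw [hdd w r] at this
      simp only [IsBetween] at hw
      omega
  have N : ∀ (x y z : HNNExtension G A B φ), IsBetween (wdist φ S) x 1 y →
      ∃ w, (IsBetween (wdist φ S) x w z ∨ IsBetween (wdist φ S) z w y) ∧
        wdist φ S 1 w ≤ 3 * δ + 2 := by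
    intro x y z h
    rw [← map_one of] at h
    have hxy := fun hx => gate_ne_of_isBetween hS hA hB h hx
    have hyx := fun hx => gate_ne_of_isBetween hS hA hB (hd.btw_symm h) hx
    obtain ⟨p, hp, hp1⟩ := exists_isDoor_isBetween (S := S) (x := x) (y := of 1) hS
      (fun h => by rwa [gate_of])
    obtain ⟨q, hq, hq1⟩ := exists_isDoor_isBetween (S := S) (x := y) (y := of 1) hS
      (fun h => by rwa [gate_of])
    obtain ⟨r, hr⟩ := exists_isDoor z
    have hpq := hd.btw_mid hp1 (hd.btw_symm hq1) h
    have hpq' : IsBetween (mulCayley S).dist p 1 q := by simpa only [IsBetween, hdd] using hpq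
    obtain ⟨w, hw, hw1⟩ := hδ p q r 1 hpq'
    have hfin : ∃ w', (IsBetween (wdist φ S) x w' z ∨ IsBetween (wdist φ S) z w' y) ∧
        wdist φ S (of w) w' ≤ 2 * δ + 2 := by
      rcases hw with hw | hw
      · exact M x y z p q r w hp hq hr hxy hw
      · obtain ⟨w', h1, h2⟩ := M y x z q p r w hq hp hr hyx (hd'.btw_symm hw)
        exact ⟨w', h1.symm.imp hd.btw_symm hd.btw_symm, h2⟩
    obtain ⟨w', h1, h2⟩ := hfin
    refine ⟨w', h1, ?_⟩
    have := hd.triangle (of 1) (of w) w'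
    rw [hdd 1 w] at this
    rw [← map_one of]
    omega
  have hinv : ∀ g x y : HNNExtension G A B φ, wdist φ S (g * x) (g * y) = wdist φ S x y :=
    mulCayley_dist_mul_left (closure_gens hS)
  intro x y z v hv
  have tr : ∀ a b c, IsBetween (wdist φ S) (v⁻¹ * a) b (v⁻¹ * c) ↔
      IsBetween (wdist φ S) a (v * b) c := by
    intro a b c
    simp only [IsBetween]
    rw [← hinv v (v⁻¹ * a) b, ← hinv v b, hinv v⁻¹, mul_inv_cancel_left, mul_inv_cancel_left]
  obtain ⟨w, hw, hw1⟩ := N (v⁻¹ * x) (v⁻¹ * y) (v⁻¹ * z) ((tr _ _ _).2 (by rwa [mul_one]))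
  refine ⟨v * w, hw.imp (tr _ _ _).1 (tr _ _ _).1, ?_⟩
  have := hinv v 1 w
  rw [mul_one] at this
  rwa [this]

/-- An HNN extension of a hyperbolic group over finite subgroups is hyperbolic. -/
theorem isHyperbolicGroup [Finite A] [Finite B] (hG : IsHyperbolicGroup G) :
    IsHyperbolicGroup (HNNExtension G A B φ) := by
  obtain ⟨S, hAB, hfin, hS, δ, hδ⟩ := hG.exists_superset
    ((Set.toFinite (A : Set G)).union (Set.toFinite (B : Set G)))
  exact isHyperbolicGroup_iff.2 ⟨gens φ S, (hfin.image _).insert _, closure_gens hS, _,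
    slimIntervals_wdist hS (Set.subset_union_left.trans hAB) (Set.subset_union_right.trans hAB) hδ⟩

/-! ### Finite subgroups -/

/-- The exponent sum of the stable letter. -/
def expSum : HNNExtension G A B φ →* Multiplicative ℤ :=
  lift 1 (Multiplicative.ofAdd 1) (by simp)

/-- Each stable letter changes the exponent sum by an odd number. Hence elements of finite order
move vertices of the tree by even distances and invert no edge. -/
theorem even_len_of_expSum_eq_one (w : HNNExtension G A B φ) :
    ∃ k : ℤ, (expSum w).toAdd = len w + 2 * k := by
  generalize hn : len w = n
  induction n generalizing w with
  | zero =>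
    obtain ⟨g, rfl⟩ := (len_eq_zero_iff w).1 hn
    exact ⟨0, by simp [expSum]⟩
  | succ n ih =>
    obtain ⟨g, u, w', rfl, -, -, h3⟩ := exists_eq_of_mul_t_mul (w := w)
      (by rw [Ne, gate_eq_none_iff_len]; omega)
    obtain ⟨k, hk⟩ := ih w' (by omega)
    have h : (expSum (of g * (t ^ (u : ℤ) * w'))).toAdd = u + (expSum w').toAdd := by
      simp [expSum]
    rw [h, hk]
    rcases Int.units_eq_one_or u with rfl | rfl
    · exact ⟨k, by push_cast; ring⟩
    · exact ⟨k - 1, by push_cast; ring⟩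

/-- Finite subgroups of an HNN extension are conjugate into the base group. -/
theorem exists_conj_of_finite (K : Subgroup (HNNExtension G A B φ)) [Finite K] :
    ∃ c, ∀ k ∈ K, ∃ g, c⁻¹ * k * c = of g := by
  obtain ⟨c, hc⟩ := exists_almost_fixed (fun x y : HNNExtension G A B φ => len (x⁻¹ * y))
    (fun g x y => by simp [mul_assoc]) 0 K (by
      intro c k hk hlt
      change 0 < len (c⁻¹ * (k * c)) at hlt
      set a := c⁻¹ * (k * c) with ha
      -- Parity excludes displacement one, so the path from `c` to `k * c` has an interior vertex.
      have hev : ∃ j : ℤ, (0 : ℤ) = len a + 2 * j := by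
        have h0 : (expSum k).toAdd = 0 := by
          have h1 : IsOfFinOrder k := by
            have := isOfFinOrder_of_finite (⟨k, hk⟩ : K)
            exact (Submonoid.isOfFinOrder_coe (x := (⟨k, hk⟩ : K))).2 this
          obtain ⟨n, hn, hn'⟩ := h1.exists_pow_eq_one
          have h2 := congrArg (fun x => (expSum x).toAdd) hn'
          simp only [map_pow, toAdd_pow, map_one, toAdd_one] at h2
          rcases mul_eq_zero.1 h2 with h | h
          · omega
          · exact h
        obtain ⟨j, hj⟩ := even_len_of_expSum_eq_one a
        refine ⟨j, ?_⟩
        rw [← hj, ha]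
        simp [h0]
      obtain ⟨g, u, a', haa, h1, -, h3⟩ := exists_eq_of_mul_t_mul (w := a)
        (by rw [Ne, gate_eq_none_iff_len]; omega)
      have ha' : gate a' ≠ none := by
        rw [Ne, gate_eq_none_iff_len]; omega
      -- This is the vertex following `c` on the path to `k * c`. The path leaves it in two
      -- different directions towards `c` and `k * c`, so from any `z` at least one of these is
      -- reached only through it.
      refine ⟨c * (of g * t ^ (u : ℤ)), fun z hz => ?_⟩
      set b : HNNExtension G A B φ := t ^ ((-u : ℤˣ) : ℤ) * of g⁻¹ with hb
      have hgb : gate b = edge A B (-u) 1 := gate_t_zpow_mul_of _ _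
      set y := (c * (of g * t ^ (u : ℤ)))⁻¹ * z with hy
      have e1 : c⁻¹ * z = b⁻¹ * y := by simp [hb, hy, mul_assoc]
      have e2 : (k * c)⁻¹ * z = a'⁻¹ * y := by
        have : k * c = c * (of g * (t ^ (u : ℤ) * a')) := by rw [← haa, ha]; group
        rw [this, hy]; group
      change len y < max (len (c⁻¹ * z)) (len ((k * c)⁻¹ * z))
      rw [e1, e2, lt_max_iff]
      clear_value y b
      by_cases hyb : gate b = gate y
      · right
        rw [len_mul (by rwa [Ne, gate_inv_eq_none_iff]) (by rw [inv_inv, ← hyb, hgb]; exact h1),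
          len_inv]
        have := mt (gate_eq_none_iff_len a').2 ha'
        omega
      · left
        have hbn : gate b ≠ none := by rw [hgb]; exact edge_ne_none _ _
        rw [len_mul (by rwa [Ne, gate_inv_eq_none_iff]) (by rwa [inv_inv]), len_inv]
        have := mt (gate_eq_none_iff_len b).2 hbn
        omega)
  refine ⟨c, fun k hk => ?_⟩
  have := hc k hk
  rw [mul_assoc]
  exact (len_eq_zero_iff _).1 (Nat.le_zero.1 this)

end HNNExtension

/-! ### Movers -/

/-- The element `t` centralizes `F`, has infinite order, its powers generate with `F` a subgroup
which contains all commensurators of `t`, and products of large powers of `t` separated by elements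
outside of this subgroup are nontrivial. -/
structure IsMover {Q : Type*} [Group Q] (F : Subgroup Q) (t : Q) : Prop where
  comm : ∀ f ∈ F, t * f = f * t
  not_torsion : ¬ IsOfFinOrder t
  mem_of_conj : ∀ (n m : ℤ) (x : Q), n ≠ 0 → t ^ n * x = x * t ^ m → x ∈ Subgroup.zpowers t ⊔ F
  prod_ne_one : ∀ l : List (ℤˣ × Q), l ≠ [] →
    l.IsChain (fun a b => a.2 ∈ Subgroup.zpowers t ⊔ F → a.1 = b.1) →
    ∀ b : Q, ∃ K : ℕ, ∀ k ≥ K, b * (l.map fun p => (t ^ k) ^ (p.1 : ℤ) * p.2).prod ≠ 1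

theorem mem_zpowers_sup_iff {Q : Type*} [Group Q] {F : Subgroup Q} {t : Q}
    (h : ∀ f ∈ F, t * f = f * t) {x : Q} :
    x ∈ Subgroup.zpowers t ⊔ F ↔ ∃ i : ℤ, ∃ f ∈ F, x = t ^ i * f := by
  have hc : ∀ (i : ℤ), ∀ f ∈ F, t ^ i * f = f * t ^ i := fun i f hf =>
    (Commute.zpow_left (h f hf : Commute t f) i).eq
  constructor
  · let V : Subgroup Q :=
      { carrier := {x | ∃ i : ℤ, ∃ f ∈ F, x = t ^ i * f}
        one_mem' := ⟨0, 1, one_mem _, by simp⟩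
        mul_mem' := by
          rintro _ _ ⟨i, f, hf, rfl⟩ ⟨j, g, hg, rfl⟩
          refine ⟨i + j, f * g, mul_mem hf hg, ?_⟩
          rw [zpow_add, mul_assoc, ← mul_assoc f, ← hc j f hf]
          simp only [mul_assoc]
        inv_mem' := by
          rintro _ ⟨i, f, hf, rfl⟩
          refine ⟨-i, f⁻¹, inv_mem hf, ?_⟩
          rw [hc i f hf, mul_inv_rev, zpow_neg] }
    have : Subgroup.zpowers t ⊔ F ≤ V := by
      refine sup_le ?_ fun f hf => ⟨0, f, hf, by simp⟩
      rw [Subgroup.zpowers_le]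
      exact ⟨1, 1, one_mem _, by simp⟩
    exact fun hx => this hx
  · rintro ⟨i, f, hf, rfl⟩
    exact mul_mem (Subgroup.mem_sup_left (Subgroup.zpow_mem_zpowers t i)) (Subgroup.mem_sup_right hf)

/-! ### The stable letter along an identity is a mover -/

namespace HNNExtension

variable {P : Type*} [Group P] {F : Subgroup P} {φ : F ≃* F}

theorem toSubgroup_self (u : ℤˣ) : toSubgroup F F u = F := by simp [toSubgroup]

theorem edge_self_eq {u v : ℤˣ} {g h : P} : edge F F u g = edge F F v h ↔ u = v ∧ g⁻¹ * h ∈ F := by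
  rw [edge_eq_edge, toSubgroup_self]

theorem units_ne_neg (u : ℤˣ) : u ≠ -u := by
  rcases Int.units_eq_one_or u with rfl | rfl <;> decide

theorem gate_t_zpow_mul {u : ℤˣ} {n : ℤ} (hn : 0 < u * n) {z : HNNExtension P F F φ}
    (hz : gate z ≠ edge F F (-u) 1) : gate (t ^ n * z) = edge F F u 1 := by
  obtain ⟨k, rfl⟩ : ∃ k : ℕ, n = u * (k + 1) := by
    refine ⟨(u * n - 1).toNat, ?_⟩
    rw [Int.toNat_of_nonneg (by omega), sub_add_cancel, ← mul_assoc]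
    rcases Int.units_eq_one_or u with rfl | rfl <;> simp
  clear hn
  induction k with
  | zero => simpa using gate_t_mul hz
  | succ k ih =>
    have : (u : ℤ) * ((k + 1 : ℕ) + 1) = u + u * (k + 1) := by push_cast; ring
    rw [this, zpow_add, mul_assoc]
    refine gate_t_mul ?_
    rw [ih, Ne, edge_self_eq]
    exact fun h => units_ne_neg u h.1

theorem exists_pos_sign {n : ℤ} (hn : n ≠ 0) : ∃ u : ℤˣ, 0 < u * n := by
  rcases lt_or_gt_of_ne hn with h | h
  · exact ⟨-1, by simpa using h⟩
  · exact ⟨1, by simpa using h⟩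

theorem gate_t_zpow_cases (n : ℤ) : gate (t ^ n : HNNExtension P F F φ) = none ∨
    ∃ u, gate (t ^ n : HNNExtension P F F φ) = edge F F u 1 := by
  by_cases hn : n = 0
  · left; rw [hn, zpow_zero, gate_one]
  · obtain ⟨u, hu⟩ := exists_pos_sign hn
    right
    refine ⟨u, ?_⟩
    have := gate_t_zpow_mul (φ := φ) hu (z := 1) (by rw [gate_one]; exact (edge_ne_none _ _).symm)
    rwa [mul_one] at this

/-- The element `a` and its inverse do not start with a power of the stable letter. -/
def IsStripped (a : HNNExtension P F F φ) : Prop :=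
  ∀ u, gate a ≠ edge F F u 1 ∧ gate a⁻¹ ≠ edge F F u 1

theorem exists_isStripped (x : HNNExtension P F F φ) :
    ∃ (i j : ℤ) (a : HNNExtension P F F φ), x = t ^ i * a * t ^ j ∧ IsStripped a := by
  generalize hn : len x = n
  induction n using Nat.strong_induction_on generalizing x with
  | _ n ih =>
  by_cases h : IsStripped x
  · exact ⟨0, 0, x, by simp, h⟩
  · simp only [IsStripped, not_forall, not_and_or, not_not] at h
    obtain ⟨u, h | h⟩ := h
    · have h1 := len_t_mul_of_eq (u := -u) (w := x) (by rwa [neg_neg])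
      obtain ⟨i, j, a, h2, h3⟩ := ih _ (by omega) (t ^ ((-u : ℤˣ) : ℤ) * x) rfl
      refine ⟨u + i, j, a, ?_, h3⟩
      rw [zpow_add, mul_assoc, mul_assoc, ← mul_assoc (t ^ i), ← h2]
      simp
    · have h1 := len_t_mul_of_eq (u := -u) (w := x⁻¹) (by rwa [neg_neg])
      rw [← len_inv, len_inv x] at h1
      obtain ⟨i, j, a, h2, h3⟩ := ih _ (by omega) (t ^ ((-u : ℤˣ) : ℤ) * x⁻¹)⁻¹ rfl
      refine ⟨i, j - u, a, ?_, h3⟩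
      rw [sub_eq_add_neg, zpow_add, ← mul_assoc, ← h2]
      simp

/-- Nothing cancels between a stripped `a` outside the base and a power of `t`, so the gate of `a`
survives. If `a` is in the base, it carries the gate of `z` to a different coset because it is not
in `F`. -/
theorem gate_stripped_mul_ne {a z : HNNExtension P F F φ} (ha : IsStripped a)
    (haF : a ∉ F.map of) (hz : gate z = none ∨ ∃ u, gate z = edge F F u 1) (v : ℤˣ) :
    gate (a * z) ≠ edge F F v 1 := by
  by_cases hn : gate a = none
  · obtain ⟨p, rfl⟩ := (gate_eq_none_iff a).1 hn
    rcases hz with hz | ⟨u, hz⟩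
    · obtain ⟨g, rfl⟩ := (gate_eq_none_iff z).1 hz
      rw [← map_mul, gate_of]
      exact (edge_ne_none _ _).symm
    · rw [(gate_of_mul_edge p).1 hz, Ne, edge_self_eq, mul_one, mul_one, inv_mem_iff]
      exact fun h => haF ⟨p, h.2, rfl⟩
  · rw [gate_mul hn]
    · exact (ha v).1
    · rcases hz with hz | ⟨u, hz⟩
      · rw [hz]; exact mt (gate_inv_eq_none_iff a).1 hn
      · rw [hz]; exact (ha u).2

theorem expSum_t : (expSum (t : HNNExtension P F F φ)) = Multiplicative.ofAdd 1 := by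
  simp [expSum]

theorem t_comm (hφ : ∀ a, φ a = a) : ∀ f ∈ F.map (of : P →* HNNExtension P F F φ),
    t * f = f * t := by
  rintro _ ⟨f, hf, rfl⟩
  have := t_mul_of (φ := φ) ⟨f, hf⟩
  rwa [hφ] at this

/-- Induction along the list; the free exponent `q` absorbs the power of `t` split off from the
preceding element. An element outside `⟨t⟩F` contains a stripped part which shields the powers on
both sides; for an element of `⟨t⟩F` followed by another factor the signs agree, so the powers
reinforce each other. -/
theorem prod_gate (hφ : ∀ a, φ a = a) (l : List (ℤˣ × HNNExtension P F F φ)) :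
    l.IsChain (fun a b => a.2 ∈ Subgroup.zpowers t ⊔ F.map of → a.1 = b.1) →
    ∀ (p : ℤˣ × HNNExtension P F F φ), p ∈ l.head? → ∀ q : ℤ, ∃ K : ℕ, ∀ k ≥ K,
      gate (t ^ q * (l.map fun p => (t ^ k) ^ (p.1 : ℤ) * p.2).prod) = edge F F p.1 1 := by
  induction l with
  | nil => intro _ p hp; simp at hp
  | cons p l ih =>
    intro hl p' hp' q
    obtain rfl : p = p' := by simpa using hp'
    obtain ⟨ε, a⟩ := p
    rw [List.isChain_cons] at hl
    have ih := ih hl.2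
    set W : ℕ → HNNExtension P F F φ :=
      fun k => (l.map fun p => (t ^ k) ^ (p.1 : ℤ) * p.2).prod with hW
    have hpos : ∀ (i : ℤ) (k : ℕ), (q + i).natAbs + 1 ≤ k → 0 < (ε : ℤ) * (q + ε * k + i) := by
      intro i k hk
      rcases Int.units_eq_one_or ε with rfl | rfl
      · simp only [Units.val_one, one_mul]; omega
      · simp only [Units.val_neg, Units.val_one, neg_mul, one_mul]; omega
    have hpow : ∀ (i : ℤ) (k : ℕ) (y : HNNExtension P F F φ),
        t ^ q * ((t ^ k) ^ (ε : ℤ) * (t ^ i * y)) = t ^ (q + ε * k + i) * y := by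
      intro i k y
      rw [zpow_add, zpow_add, mul_comm (ε : ℤ), zpow_mul, zpow_natCast]
      simp only [mul_assoc]
    have main : ∃ (i : ℤ) (z : HNNExtension P F F φ) (K : ℕ), a = t ^ i * z ∧
        ∀ k ≥ K, gate (z * W k) ≠ edge F F (-ε) 1 := by
      by_cases ha : a ∈ Subgroup.zpowers t ⊔ F.map of
      · obtain ⟨i, _, ⟨f, hf, rfl⟩, rfl⟩ := (mem_zpowers_sup_iff (t_comm hφ)).1 ha
        cases l with
        | nil =>
          refine ⟨i, of f, 0, rfl, fun k _ => ?_⟩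
          simp only [hW, List.map_nil, List.prod_nil, mul_one, gate_of]
          exact (edge_ne_none _ _).symm
        | cons p' l' =>
          obtain ⟨K, hK⟩ := ih p' (by simp) 0
          refine ⟨i, of f, K, rfl, fun k hk => ?_⟩
          have h1 := hK k hk
          rw [zpow_zero, one_mul] at h1
          have h2 := hl.1 p' (by simp) ha
          dsimp only at h2
          rw [(gate_of_mul_edge f).1 h1, ← h2, Ne, edge_self_eq]
          exact fun h => units_ne_neg ε h.1
      · obtain ⟨i, j, a₀, rfl, hst⟩ := exists_isStripped a
        have haF : a₀ ∉ F.map of := fun h => ha (by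
          refine mul_mem (mul_mem (Subgroup.mem_sup_left ?_) (Subgroup.mem_sup_right h))
            (Subgroup.mem_sup_left ?_) <;> exact Subgroup.zpow_mem_zpowers _ _)
        have : ∃ K : ℕ, ∀ k ≥ K, gate (t ^ j * W k) = none ∨
            ∃ u, gate (t ^ j * W k) = edge F F u 1 := by
          cases l with
          | nil => exact ⟨0, fun k _ => by simpa [hW] using gate_t_zpow_cases j⟩
          | cons p' l' =>
            obtain ⟨K, hK⟩ := ih p' (by simp) j
            exact ⟨K, fun k hk => Or.inr ⟨_, hK k hk⟩⟩
        obtain ⟨K, hK⟩ := this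
        refine ⟨i, a₀ * t ^ j, K, by simp only [mul_assoc], fun k hk => ?_⟩
        rw [mul_assoc]
        exact gate_stripped_mul_ne hst haF (hK k hk) _
    obtain ⟨i, z, K, rfl, hK⟩ := main
    -- Beyond `|q + i|` the exponent `q + ε * k + i` has the sign `ε`.
    refine ⟨max K ((q + i).natAbs + 1), fun k hk => ?_⟩
    rw [List.map_cons, List.prod_cons]
    dsimp only
    change gate (t ^ q * ((t ^ k) ^ (ε : ℤ) * (t ^ i * z) * W k)) = _
    rw [mul_assoc, mul_assoc, hpow]
    exact gate_t_zpow_mul (hpos i k (le_of_max_le_right hk)) (hK k (le_of_max_le_left hk))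

theorem exists_gate_zpow_mul_ne (y : HNNExtension P F F φ) (u : ℤˣ) :
    ∃ q : ℤ, gate (t ^ q * y) ≠ edge F F u 1 := by
  generalize hn : len y = n
  induction n using Nat.strong_induction_on generalizing y with
  | _ n ih =>
  by_cases h : gate y = edge F F u 1
  · have h1 := len_t_mul_of_eq (u := -u) (w := y) (by rwa [neg_neg])
    obtain ⟨q, hq⟩ := ih _ (by omega) (t ^ ((-u : ℤˣ) : ℤ) * y) rfl
    exact ⟨q + (-u : ℤˣ), by rwa [zpow_add, mul_assoc]⟩
  · exact ⟨0, by simpa using h⟩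

/-- The stable letter of an HNN extension along the identity of a subgroup is a mover. -/
theorem isMover_t (hφ : ∀ a, φ a = a) :
    IsMover (F.map (of : P →* HNNExtension P F F φ)) t where
  comm := t_comm hφ
  not_torsion := by
    rw [isOfFinOrder_iff_pow_eq_one]
    rintro ⟨n, hn, h⟩
    have := congrArg (fun x => (expSum x).toAdd) h
    simp only [map_pow, expSum_t, toAdd_pow, toAdd_ofAdd, map_one, toAdd_one] at this
    simp at this
    omega
  mem_of_conj := by
    intro n m x hn h
    obtain rfl : n = m := by
      have := congrArg (fun x => (expSum x).toAdd) h
      simp only [map_mul, map_zpow, expSum_t, toAdd_mul, toAdd_zpow, toAdd_ofAdd] at this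
      simp at this
      omega
    obtain ⟨i, j, a, rfl, ha⟩ := exists_isStripped x
    have h' : t ^ n * a = a * t ^ n := by
      have h1 : t ^ i * (t ^ n * a) * t ^ j = t ^ i * (a * t ^ n) * t ^ j := by
        calc t ^ i * (t ^ n * a) * t ^ j = t ^ n * (t ^ i * a * t ^ j) := by
              rw [← mul_assoc, ← zpow_add, add_comm, zpow_add]; simp only [mul_assoc]
          _ = _ := h
          _ = _ := by
              simp only [mul_assoc]
              rw [← zpow_add, add_comm, zpow_add]
      exact mul_left_cancel (mul_right_cancel h1)
    obtain ⟨u, hu⟩ := exists_pos_sign hn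
    -- Now `t ^ n * a` starts with a stable letter over the trivial coset of `F`, while `a * t ^ n`
    -- starts like `a`, which is stripped, unless `a` is in the base; in that case comparing cosets
    -- gives an element of `F`.
    have h1 := gate_t_zpow_mul hu (ha (-u)).1
    have h2 := gate_t_zpow_mul (φ := φ) hu (z := 1)
      (by rw [gate_one]; exact (edge_ne_none _ _).symm)
    rw [mul_one] at h2
    by_cases hna : gate a = none
    · obtain ⟨p, rfl⟩ := (gate_eq_none_iff a).1 hna
      rw [h', (gate_of_mul_edge p).1 h2, edge_self_eq, mul_one, mul_one, inv_mem_iff] at h1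
      refine mul_mem (mul_mem (Subgroup.mem_sup_left ?_) (Subgroup.mem_sup_right ⟨p, h1.2, rfl⟩))
        (Subgroup.mem_sup_left ?_) <;> exact Subgroup.zpow_mem_zpowers _ _
    · rw [h', gate_mul hna (by rw [h2]; exact (ha u).2)] at h1
      exact absurd h1 (ha u).1
  prod_ne_one := by
    intro l hl hc b
    obtain ⟨p, l', rfl⟩ := List.exists_cons_of_ne_nil hl
    -- The prefix `b` is fixed: after multiplication by `t ^ q` its inverse no longer starts with
    -- the sign `p.1`, but the product does for all large `k`.
    obtain ⟨q, hq⟩ := exists_gate_zpow_mul_ne b⁻¹ p.1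
    obtain ⟨K, hK⟩ := prod_gate hφ _ hc p (by simp) q
    refine ⟨K, fun k hk h => hq ?_⟩
    rw [inv_eq_of_mul_eq_one_right h]
    exact hK k hk

end HNNExtension

/-! ### Maximal virtually abelian subgroups of movers -/

namespace IsMover

open Subgroup

variable {Q R : Type*} [Group Q] [Group R] {F : Subgroup Q} {t : Q}

theorem map (h : IsMover F t) (e : Q ≃* R) : IsMover (F.map e.toMonoidHom) (e t) := by
  have hV : ∀ x, x ∈ zpowers (e t) ⊔ F.map e.toMonoidHom ↔ e.symm x ∈ zpowers t ⊔ F := by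
    intro x
    have : zpowers (e t) ⊔ F.map e.toMonoidHom = (zpowers t ⊔ F).map e.toMonoidHom := by
      rw [Subgroup.map_sup, MonoidHom.map_zpowers]; rfl
    rw [this]
    exact Subgroup.mem_map_equiv
  refine ⟨?_, ?_, ?_, ?_⟩
  · rintro _ ⟨f, hf, rfl⟩
    have := congrArg e (h.comm f hf)
    simpa using this
  · exact fun hc => h.not_torsion ((e.injective.isOfFinOrder_iff (f := e.toMonoidHom)).1 hc)
  · intro n m x hn hx
    rw [hV]
    refine h.mem_of_conj n m _ hn (e.injective ?_)
    simpa using hx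
  · intro l hl hc b
    obtain ⟨K, hK⟩ := h.prod_ne_one (l.map fun p => (p.1, e.symm p.2)) (by simpa using hl)
      (by rw [List.isChain_map]; exact hc.imp fun a b hab ha => hab ((hV _).2 ha)) (e.symm b)
    refine ⟨K, fun k hk hb => hK k hk (e.injective ?_)⟩
    rw [map_one, ← hb, map_mul, map_list_prod, List.map_map, List.map_map]
    simp [Function.comp_def]

theorem conj (h : IsMover F t) (c : Q) :
    IsMover (F.map (MulAut.conj c).toMonoidHom) (c * t * c⁻¹) := h.map (MulAut.conj c)

theorem conj_of_comm (h : IsMover F t) {s : Q} (hs : ∀ f ∈ F, s * f = f * s) :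
    IsMover F (s * t * s⁻¹) := by
  have := h.conj s
  have h2 : F.map (MulAut.conj s).toMonoidHom = F := by
    have h3 : ∀ f ∈ F, s * f * s⁻¹ = f := fun f hf => by rw [hs f hf]; group
    ext x
    constructor
    · rintro ⟨f, hf, rfl⟩
      change s * f * s⁻¹ ∈ F
      rwa [h3 f hf]
    · intro hx
      exact ⟨x, hx, h3 x hx⟩
  rwa [h2] at this

theorem pow_card (h : IsMover F t) [Finite F] {f : Q} (hf : f ∈ F) (i : ℤ) :
    (t ^ i * f) ^ Nat.card F = t ^ (i * Nat.card F) := by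
  have hc : Commute (t ^ i) f := Commute.zpow_left (h.comm f hf) i
  have h1 : f ^ Nat.card F = 1 := by
    exact congrArg Subtype.val (pow_card_eq_one' (x := (⟨f, hf⟩ : F)))
  rw [hc.mul_pow, h1, mul_one, zpow_mul, zpow_natCast]

theorem zpow_eq_one (h : IsMover F t) {i : ℤ} (hi : t ^ i = 1) : i = 0 := by
  by_contra hne
  exact h.not_torsion (isOfFinOrder_iff_zpow_eq_one.2 ⟨i, hne, hi⟩)

theorem card_ne_zero [Finite F] : (Nat.card F : ℤ) ≠ 0 := by
  exact_mod_cast Nat.card_pos.ne'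

theorem isInternalDirectProduct (h : IsMover F t) [Finite F] :
    IsInternalDirectProduct (zpowers t ⊔ F) (zpowers t) F := by
  refine ⟨rfl, ?_, ?_⟩
  · rw [eq_bot_iff]
    rintro _ ⟨⟨i, rfl⟩, hi⟩
    have h1 := h.pow_card hi 0
    simp only [zpow_zero, one_mul, zero_mul] at h1
    rw [← zpow_natCast, ← zpow_mul] at h1
    have h2 := h.zpow_eq_one h1
    rcases mul_eq_zero.1 h2 with h3 | h3
    · simp [h3]
    · exact absurd h3 card_ne_zero
  · rintro _ ⟨i, rfl⟩ f hf
    exact (Commute.zpow_left (h.comm f hf : Commute t f) i).eq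

theorem isVirtuallyAbelian (h : IsMover F t) [Finite F] :
    IsVirtuallyAbelian (zpowers t ⊔ F : Subgroup Q) := by
  refine ⟨(zpowers t).subgroupOf (zpowers t ⊔ F), ?_, ?_⟩
  · rintro ⟨_, _⟩ ⟨i, rfl⟩ ⟨_, _⟩ ⟨j, rfl⟩
    apply Subtype.ext
    exact (Commute.zpow_zpow_self t i j).eq
  · constructor
    change (zpowers t).relIndex (zpowers t ⊔ F) ≠ 0
    have key : Finite ((zpowers t ⊔ F : Subgroup Q) ⧸ (zpowers t).subgroupOf (zpowers t ⊔ F)) := by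
      refine Finite.of_surjective (fun f : F =>
        (QuotientGroup.mk (⟨f, mem_sup_right f.2⟩ : (zpowers t ⊔ F : Subgroup Q)))) fun x => ?_
      obtain ⟨⟨x, hx⟩, rfl⟩ := QuotientGroup.mk_surjective x
      obtain ⟨i, f, hf, rfl⟩ := (mem_zpowers_sup_iff h.comm).1 hx
      refine ⟨⟨f, hf⟩, QuotientGroup.eq.2 ⟨i, ?_⟩⟩
      change t ^ i = f⁻¹ * (t ^ i * f)
      rw [(Commute.zpow_left (h.comm f hf : Commute t f) i).eq]
      group
    have : Nat.card ((zpowers t ⊔ F : Subgroup Q) ⧸ (zpowers t).subgroupOf (zpowers t ⊔ F)) ≠ 0 :=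
      Nat.card_pos.ne'
    exact this

/-- Some power of `t` lies in a normal abelian subgroup of `N`, so it commutes with its conjugates
by elements of `N`. The commensurator property puts these conjugates into `⟨t⟩F`; their `|F|`-th
powers are powers of `t`, and the property applies again to the conjugating elements. -/
theorem le_of_isVirtuallyAbelian (h : IsMover F t) [Finite F] {N : Subgroup Q} (ht : t ∈ N)
    (hN : IsVirtuallyAbelian N) : N ≤ zpowers t ⊔ F := by
  obtain ⟨A, hA, hfin⟩ := hN
  intro n hn
  have hnc : A.normalCore.FiniteIndex := inferInstance
  obtain ⟨k, hk, -, hkA⟩ := Subgroup.exists_pow_mem_of_index_ne_zero hnc.index_ne_zero (⟨t, ht⟩ : N)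
  have hconj := A.normalCore_normal.conj_mem _ hkA ⟨n, hn⟩
  have hcomm := congrArg Subtype.val
    (hA _ (A.normalCore_le hkA) _ (A.normalCore_le hconj))
  simp only [Subgroup.coe_mul, Subgroup.coe_pow, Subgroup.coe_inv] at hcomm
  have h1 : n * t ^ k * n⁻¹ ∈ zpowers t ⊔ F := by
    refine h.mem_of_conj k k _ (by omega) ?_
    simpa using hcomm
  obtain ⟨a, f, hf, haf⟩ := (mem_zpowers_sup_iff h.comm).1 h1
  have h2 := congrArg (· ^ Nat.card F) haf
  simp only [conj_pow, h.pow_card hf, ← pow_mul] at h2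
  have hpos := card_ne_zero (F := F)
  refine h.mem_of_conj (a * Nat.card F) (k * Nat.card F : ℕ) n ?_ ?_
  · refine mul_ne_zero (fun ha => ?_) hpos
    rw [ha, zero_mul, zpow_zero, conj_eq_one_iff, ← zpow_natCast] at h2
    have := h.zpow_eq_one h2
    push_cast at this
    rcases mul_eq_zero.1 this with h3 | h3
    · omega
    · exact hpos h3
  · rw [← h2, zpow_natCast]; group

theorem isMaximalVirtuallyAbelianAt (h : IsMover F t) [Finite F] :
    IsMaximalVirtuallyAbelianAt t (zpowers t ⊔ F) := by
  have ht : t ∈ zpowers t ⊔ F := mem_sup_left (mem_zpowers t)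
  refine ⟨ht, ⟨h.isVirtuallyAbelian, fun N hN hle => ?_⟩, fun N hN hmax => ?_⟩
  · exact h.le_of_isVirtuallyAbelian (hle ht) hN
  · have hle := h.le_of_isVirtuallyAbelian hN hmax.1
    exact le_antisymm hle (hmax.2 h.isVirtuallyAbelian hle)

/-- Taking the `|F|`-th power of a common element outside `F` shows that `s` conjugates a power of
`t` to a nontrivial power of `t`, which forces `s` into `⟨t⟩F`. -/
theorem mem_of_mem_conj (h : IsMover F t) [Finite F] {s : Q} (hs : ∀ f ∈ F, s * f = f * s)
    (hsV : s ∉ zpowers t ⊔ F) {x : Q} (hx : x ∈ zpowers t ⊔ F)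
    (hx' : x ∈ zpowers (s * t * s⁻¹) ⊔ F) : x ∈ F := by
  obtain ⟨i, f, hf, rfl⟩ := (mem_zpowers_sup_iff h.comm).1 hx
  by_cases hi : i = 0
  · simpa [hi] using hf
  have h' := h.conj_of_comm hs
  obtain ⟨j, f', hf', hj⟩ := (mem_zpowers_sup_iff h'.comm).1 hx'
  have h2 := congrArg (· ^ Nat.card F) hj
  simp only [h.pow_card hf, h'.pow_card hf'] at h2
  rw [conj_zpow] at h2
  refine absurd (h.mem_of_conj (i * Nat.card F) (j * Nat.card F) s (mul_ne_zero hi (card_ne_zero (F := F))) ?_) hsV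
  rw [h2]
  group

end IsMover

/-- Every finite subgroup `F` has a mover, and the elements commuting with `F` provide infinitely
many others. -/
def HasMovers (Q : Type*) [Group Q] : Prop :=
  ∀ F : Subgroup Q, Finite F → ∃ t s : Q, IsMover F t ∧ (∀ f ∈ F, s * f = f * s) ∧
    ∀ n : ℤ, n ≠ 0 → s ^ n ∉ Subgroup.zpowers t ⊔ F

/-! ### Infinitely many independent movers -/

namespace HasMovers

open Subgroup

variable {Q : Type*} [Group Q]

theorem exists_seq (h : HasMovers Q) (F : Subgroup Q) [Finite F] :
    ∃ g : ℕ → Q, (∀ n, IsMover F (g n)) ∧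
      ∀ m n, m ≠ n → ∀ x, x ∈ zpowers (g m) ⊔ F → x ∈ zpowers (g n) ⊔ F → x ∈ F := by
  obtain ⟨t, s, ht, hs, hsV⟩ := h F inferInstance
  have hsn : ∀ n : ℤ, ∀ f ∈ F, s ^ n * f = f * s ^ n := fun n f hf =>
    (Commute.zpow_left (hs f hf : Commute s f) n).eq
  refine ⟨fun n => s ^ (n : ℤ) * t * (s ^ (n : ℤ))⁻¹, fun n => ht.conj_of_comm (hsn n), ?_⟩
  intro m n hmn x hx hx'
  have hm := ht.conj_of_comm (hsn m)
  refine hm.mem_of_mem_conj (s := s ^ ((n : ℤ) - m)) (hsn _) (fun hc => ?_) hx ?_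
  · obtain ⟨i, f, hf, hi⟩ := (mem_zpowers_sup_iff hm.comm).1 hc
    refine hsV ((n : ℤ) - m) (by omega) ((mem_zpowers_sup_iff ht.comm).2 ⟨i, f, hf, ?_⟩)
    have : (s ^ (m : ℤ))⁻¹ * s ^ ((n : ℤ) - m) * s ^ (m : ℤ) = s ^ ((n : ℤ) - m) := by
      rw [← zpow_neg, ← zpow_add, ← zpow_add]; congr 1; ring
    rw [← this, hi, conj_zpow]
    simp only [mul_assoc, inv_mul_cancel_left]
    rw [← hsn m f hf]
    simp
  · have : s ^ ((n : ℤ) - m) * (s ^ (m : ℤ) * t * (s ^ (m : ℤ))⁻¹) * (s ^ ((n : ℤ) - m))⁻¹ =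
        s ^ (n : ℤ) * t * (s ^ (n : ℤ))⁻¹ := by
      rw [zpow_sub]; group
    rwa [this]

/-- An element outside `F` lies in at most one of the subgroups `⟨g n⟩F`, so a finite set excludes
only finitely many `n`. -/
theorem exists_avoiding (h : HasMovers Q) (F : Subgroup Q) [Finite F] {X : Set Q} (hX : X.Finite)
    (hXF : ∀ x ∈ X, x ∉ F) : ∃ g, IsMover F g ∧ ∀ x ∈ X, x ∉ zpowers g ⊔ F := by
  obtain ⟨g, hg, hgg⟩ := h.exists_seq F
  have hfin : (⋃ x ∈ X, {n | x ∈ zpowers (g n) ⊔ F}).Finite := by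
    refine hX.biUnion fun x hx => Set.Subsingleton.finite fun m hm n hn => ?_
    by_contra hmn
    exact hXF x hx (hgg m n hmn x hm hn)
  obtain ⟨n, hn⟩ := hfin.exists_notMem
  refine ⟨g n, hg n, fun x hx hxn => hn ?_⟩
  simp only [Set.mem_iUnion]
  exact ⟨x, hx, hxn⟩

theorem isTorsionSaturated (h : HasMovers Q)
    (hc : ∀ (F₁ F₂ : Subgroup Q) (α : F₁ ≃* F₂), Finite F₁ → Finite F₂ →
      ∃ g : Q, ∀ x : F₁, g * (x : Q) * g⁻¹ = (α x : Q)) : IsTorsionSaturated Q where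
  conj_of_finite := hc
  exists_maximal F hF := by
    obtain ⟨g, hg, hgg⟩ := h.exists_seq F
    refine ⟨g, fun n => zpowers (g n) ⊔ F, fun n => (hg n).not_torsion,
      fun n => (hg n).isMaximalVirtuallyAbelianAt, fun n => (hg n).isInternalDirectProduct,
      fun m n hmn heq => (hg m).not_torsion ?_⟩
    have hm : g m ∈ zpowers (g m) ⊔ F := mem_sup_left (mem_zpowers _)
    have hF := hgg m n hmn (g m) hm (heq.le hm)
    have := isOfFinOrder_of_finite (⟨g m, hF⟩ : F)
    exact (Submonoid.isOfFinOrder_coe (x := (⟨g m, hF⟩ : F))).2 this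

end HasMovers

/-! ### Limit groups over a group with movers -/

section Residual

variable {Γ G : Type*} [Group Γ] [Group G]

theorem isFullyResidually_iff : IsFullyResidually Γ G ↔
    ∀ E : Set G, E.Finite → (∀ e ∈ E, e ≠ 1) → ∃ f : G →* Γ, ∀ e ∈ E, f e ≠ 1 := by
  constructor
  · intro h E hE hE1
    obtain ⟨f, hf⟩ := h (insert 1 E) (hE.insert 1)
    refine ⟨f, fun e he h1 => hE1 e he (hf (Set.mem_insert_of_mem _ he) (Set.mem_insert _ _) ?_)⟩
    rw [h1, map_one]
  · intro h E hE
    obtain ⟨f, hf⟩ := h ((Set.image2 (fun a b => a * b⁻¹) E E) \ {1})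
      ((hE.image2 _ hE).subset Set.sdiff_subset) (fun e he => he.2)
    refine ⟨f, fun a ha b hb hab => ?_⟩
    by_contra hne
    refine hf (a * b⁻¹) ⟨⟨a, ha, b, hb, rfl⟩, fun h1 => hne (mul_inv_eq_one.1 h1)⟩ ?_
    rw [map_mul, map_inv, hab, mul_inv_cancel]

theorem exists_uniform {α : Type*} {E : Set α} (hE : E.Finite) {P : α → ℕ → Prop}
    (h : ∀ w ∈ E, ∃ K, ∀ k ≥ K, P w k) : ∃ k, ∀ w ∈ E, P w k :=
  ((Filter.eventually_all_finite hE).2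
    fun w hw => Filter.eventually_atTop.2 (h w hw)).exists

end Residual

/-- Isomorphisms between finite subgroups are induced by conjugations. -/
def ConjOfFinite (Γ : Type*) [Group Γ] : Prop :=
  ∀ (F₁ F₂ : Subgroup Γ) (α : F₁ ≃* F₂), Finite F₁ → Finite F₂ →
    ∃ g : Γ, ∀ x : F₁, g * (x : Γ) * g⁻¹ = (α x : Γ)

theorem MonoidHom.finite_range_of_finite {F Γ : Type*} [Group F] [Group Γ] [Finite F]
    (f : F →* Γ) : Finite f.range :=
  (Set.finite_range f).to_subtype

theorem ConjOfFinite.exists_conj {Γ F : Type*} [Group Γ] [Group F] [Finite F] (h : ConjOfFinite Γ)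
    {f₁ f₂ : F →* Γ} (h₁ : Function.Injective f₁) (h₂ : Function.Injective f₂) :
    ∃ c : Γ, ∀ x, c * f₁ x * c⁻¹ = f₂ x := by
  obtain ⟨c, hc⟩ := h f₁.range f₂.range
    ((MonoidHom.ofInjective h₁).symm.trans (MonoidHom.ofInjective h₂))
    f₁.finite_range_of_finite f₂.finite_range_of_finite
  refine ⟨c, fun x => ?_⟩
  have := hc (MonoidHom.ofInjective h₁ x)
  rwa [MulEquiv.trans_apply, MulEquiv.symm_apply_apply] at this

/-! ### Amalgamated products of limit groups -/

section Amalgam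

open Monoid Subgroup

theorem pushoutI_fg {A : Fin 2 → Type*} [∀ i, Group (A i)] {F : Type*} [Group F]
    (φ : ∀ i, F →* A i) (h : ∀ i, Group.FG (A i)) : Group.FG (PushoutI φ) := by
  choose S hS hfin using fun i => Group.fg_iff.1 (h i)
  refine Group.fg_iff.2 ⟨⋃ i, PushoutI.of i '' S i, ?_, Set.finite_iUnion fun i => (hfin i).image _⟩
  have key : ∀ i (g : A i), PushoutI.of (φ := φ) i g ∈ closure (⋃ i, PushoutI.of i '' S i) := by
    intro i g
    have h1 : (closure (S i)).map (PushoutI.of (φ := φ) i) ≤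
        closure (⋃ i, PushoutI.of i '' S i) := by
      rw [MonoidHom.map_closure]
      exact Subgroup.closure_mono (Set.subset_iUnion (fun i => PushoutI.of (φ := φ) i '' S i) i)
    exact h1 ⟨g, by rw [hS]; trivial, rfl⟩
  refine (eq_top_iff' _).2 fun x => ?_
  induction x using PushoutI.induction_on with
  | of i g => exact key i g
  | base h => rw [← PushoutI.of_apply_eq_base φ 0]; exact key 0 _
  | mul x y hx hy => exact mul_mem hx hy

/-- Opposite signs for the two factors. -/
def factorSign (i : Fin 2) : ℤˣ := if i = 0 then -1 else 1

theorem factorSign_of_ne {i j : Fin 2} (h : i ≠ j) : factorSign j = -factorSign i := by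
  fin_cases i <;> fin_cases j <;> simp_all [factorSign]

variable {Γ : Type*} [Group Γ] {A : Fin 2 → Type*} [∀ i, Group (A i)]

/-- Separate the letters of a word in two groups by signs. -/
def spreadWord (f : ∀ i, A i →* Γ) (L : List (Σ i, A i)) : List (ℤˣ × Γ) :=
  L.flatMap fun x => [(factorSign x.1, f x.1 x.2), (-factorSign x.1, 1)]

theorem isChain_spreadWord (f : ∀ i, A i →* Γ) (V : Subgroup Γ) (L : List (Σ i, A i))
    (hL : L.IsChain fun a b => a.1 ≠ b.1) (hV : ∀ x ∈ L, f x.1 x.2 ∉ V) :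
    (spreadWord f L).IsChain fun a b => a.2 ∈ V → a.1 = b.1 := by
  induction L with
  | nil => simp [spreadWord]
  | cons x L ih =>
    have ih := ih (List.isChain_cons.1 hL).2 fun y hy => hV y (List.mem_cons_of_mem _ hy)
    simp only [spreadWord, List.flatMap_cons, List.cons_append, List.nil_append] at ih ⊢
    rw [List.isChain_cons, List.isChain_cons]
    refine ⟨?_, ?_, ih⟩
    · intro y _ hx
      exact absurd hx (hV x List.mem_cons_self)
    -- The second entry belonging to a letter is `1`, which lies in `V`. The signs then agree
    -- because consecutive letters come from different factors.
    · intro y hy _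
      cases L with
      | nil => simp at hy
      | cons x' L' =>
        have hne := (List.isChain_cons.1 hL).1 x' (by simp)
        simp only [List.flatMap_cons, List.cons_append, List.head?_cons, Option.mem_def,
          Option.some.injEq] at hy
        rw [← hy]
        exact (factorSign_of_ne hne).symm

theorem prod_spreadWord (f : ∀ i, A i →* Γ) (g : Γ) (L : List (Σ i, A i)) :
    ((spreadWord f L).map fun p => g ^ (p.1 : ℤ) * p.2).prod =
      (L.map fun x => MulAut.conj (g ^ (factorSign x.1 : ℤ)) (f x.1 x.2)).prod := by
  induction L with
  | nil => simp [spreadWord]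
  | cons x L ih =>
    simp only [spreadWord] at ih
    rw [List.map_cons, List.prod_cons, ← ih]
    simp only [spreadWord, List.flatMap_cons, List.map_append, List.prod_append, List.map_cons,
      List.map_nil, List.prod_cons, List.prod_nil, Units.val_neg, zpow_neg, mul_one,
      MulAut.conj_apply, mul_assoc]

end Amalgam

section

open Monoid Subgroup

theorem limitGroupsClosedUnderAmalgams {Γ : Type u} [Group Γ] (hm : HasMovers Γ)
    (hc : ConjOfFinite Γ) : LimitGroupsClosedUnderAmalgams Γ := by
  intro A _ F _ _ φ hφ hA
  refine ⟨pushoutI_fg φ fun i => (hA i).1, isFullyResidually_iff.2 fun E hE hE1 => ?_⟩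
  classical
  obtain ⟨d⟩ := PushoutI.NormalWord.transversal_nonempty φ hφ
  have hnf : ∀ w : PushoutI φ, ∃ n : PushoutI.NormalWord d, n.prod = w := fun w =>
    ⟨PushoutI.NormalWord.equiv w, PushoutI.NormalWord.equiv.symm_apply_apply w⟩
  choose nw hnw using hnf
  -- the letters occurring in the elements of `E`
  set L : ∀ i, Set (A i) := fun i => {x | ∃ w ∈ E, ⟨i, x⟩ ∈ (nw w).toList} with hLdef
  have hLfin : ∀ i, (L i).Finite := by
    intro i
    have h1 : (⋃ w ∈ E, {x | x ∈ (nw w).toList}).Finite :=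
      hE.biUnion fun w _ => List.finite_toSet _
    refine (h1.preimage (f := Sigma.mk i) sigma_mk_injective.injOn).subset ?_
    rintro x ⟨w, hw, hx⟩
    simp only [Set.mem_preimage, Set.mem_iUnion]
    exact ⟨w, hw, hx⟩
  -- Letters are nontrivial representatives from a transversal which contains `1`, so they do not
  -- represent the trivial coset.
  have hLF : ∀ i, ∀ x ∈ L i, x ∉ (φ i).range := by
    rintro i x ⟨w, hw, hx⟩ hxF
    have h1 := (d.compl i).equiv_snd_eq_self_of_mem_of_one_mem (one_mem _)
      ((nw w).normalized i x hx)
    have h2 := (d.compl i).equiv_snd_eq_one_of_mem_of_one_mem (d.one_mem i) hxF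
    rw [h2] at h1
    exact (nw w).ne_one _ hx (by simpa using h1.symm)
  have hex : ∀ i, ∃ f : A i →* Γ, Set.InjOn f (L i ∪ (φ i).range) := fun i =>
    (hA i).2 _ ((hLfin i).union (Set.finite_range _))
  choose f₀ hf₀ using hex
  have hinj₀ : ∀ i, Function.Injective ((f₀ i).comp (φ i)) := fun i x y hxy =>
    hφ i (hf₀ i (Or.inr ⟨x, rfl⟩) (Or.inr ⟨y, rfl⟩) hxy)
  -- The given homomorphisms are injective on the amalgamated subgroup but need not agree there;
  -- torsion saturation corrects this by conjugations.
  choose c hcc using fun i => hc.exists_conj (hinj₀ i) (hinj₀ 0)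
  set k : F →* Γ := (f₀ 0).comp (φ 0) with hk
  set f : ∀ i, A i →* Γ := fun i => (MulAut.conj (c i)).toMonoidHom.comp (f₀ i) with hf
  have hfk : ∀ i x, f i (φ i x) = k x := fun i x => hcc i x
  have hfinj : ∀ i, Set.InjOn (f i) (L i ∪ (φ i).range) := fun i x hx y hy hxy =>
    hf₀ i hx hy ((MulAut.conj (c i)).injective hxy)
  have := k.finite_range_of_finite
  obtain ⟨g, hg, hgX⟩ := hm.exists_avoiding k.range (X := ⋃ i, f i '' L i)
    (Set.finite_iUnion fun i => (hLfin i).image _) (by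
      simp only [Set.mem_iUnion]
      rintro _ ⟨i, x, hx, rfl⟩ ⟨y, hy⟩
      rw [← hfk i] at hy
      exact hLF i x hx ⟨y, hfinj i (Or.inr ⟨y, rfl⟩) (Or.inl hx) hy⟩)
  -- Conjugation by powers of `g` fixes `k.range`, so the twisted homomorphisms still agree on the
  -- amalgamated subgroup.
  have hcomm : ∀ (n : ℤ) x, MulAut.conj (g ^ n) (k x) = k x := by
    intro n x
    rw [MulAut.conj_apply, (Commute.zpow_left (hg.comm (k x) ⟨x, rfl⟩ : Commute g (k x)) n).eq]
    group
  set Ψ : ℕ → PushoutI φ →* Γ := fun n => PushoutI.lift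
    (fun i => (MulAut.conj ((g ^ n) ^ (factorSign i : ℤ))).toMonoidHom.comp (f i)) k (by
      intro i
      ext x
      have := hcomm (n * factorSign i) x
      rw [zpow_mul, zpow_natCast] at this
      simpa [hfk] using this) with hΨ
  have hΨw : ∀ n w, Ψ n w = k (nw w).head *
      ((spreadWord f (nw w).toList).map fun p => (g ^ n) ^ (p.1 : ℤ) * p.2).prod := by
    intro n w
    conv_lhs => rw [← hnw w, PushoutI.NormalWord.prod, map_mul]
    rw [prod_spreadWord, CoprodI.Word.prod, map_list_prod, map_list_prod, List.map_map,
      List.map_map]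
    congr 1
  obtain ⟨n, hn⟩ := exists_uniform (P := fun w n => Ψ n w ≠ 1) hE (by
    intro w hw
    by_cases hnil : (nw w).toList = []
    · refine ⟨0, fun n _ h1 => hE1 w hw ?_⟩
      rw [hΨw, hnil] at h1
      simp only [spreadWord, List.flatMap_nil, List.map_nil, List.prod_nil, mul_one] at h1
      have h2 : (nw w).head = 1 := hinj₀ 0 (by rw [map_one]; exact h1)
      rw [← hnw w, PushoutI.NormalWord.prod, CoprodI.Word.prod, hnil, h2]
      simp
    · obtain ⟨K, hK⟩ := hg.prod_ne_one (spreadWord f (nw w).toList) (by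
          obtain ⟨x, l, hl⟩ := List.exists_cons_of_ne_nil hnil
          simp [spreadWord, hl])
        (isChain_spreadWord f _ _ (nw w).chain_ne fun x hx =>
          hgX _ (Set.mem_iUnion.2 ⟨x.1, x.2, ⟨w, hw, hx⟩, rfl⟩)) (k (nw w).head)
      exact ⟨K, fun n hn => by rw [hΨw]; exact hK n hn⟩)
  exact ⟨Ψ n, hn⟩

end

/-! ### HNN extensions of limit groups -/

section HNN

open HNNExtension Subgroup

variable {Γ H : Type*} [Group Γ] [Group H]

/-- The part of `(c * g) ^ ε` to the left of `g ^ ε`. -/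
def preFactor (c : Γ) (ε : ℤˣ) : Γ := if ε = 1 then c else 1

/-- The part of `(c * g) ^ ε` to the right of `g ^ ε`. -/
def postFactor (c : Γ) (ε : ℤˣ) : Γ := if ε = 1 then 1 else c⁻¹

theorem mul_zpow_units (c g : Γ) (ε : ℤˣ) :
    (c * g) ^ (ε : ℤ) = preFactor c ε * g ^ (ε : ℤ) * postFactor c ε := by
  rcases Int.units_eq_one_or ε with rfl | rfl <;> simp [preFactor, postFactor]

/-- Regroups the factors between consecutive powers of `g`: the element separating them consists of
what `c` leaves on the right of one power, the letter, and what `c` leaves on the left of the next.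
-/
theorem exists_spread_hnn (f : H →* Γ) (c g : Γ) (V : Subgroup Γ) (R : ℤˣ × H → ℤˣ × H → Prop)
    (l : List (ℤˣ × H)) (hl : l.IsChain R)
    (hR : ∀ p ∈ l, ∀ q, R p q → postFactor c p.1 * f p.2 * preFactor c q.1 ∈ V → p.1 = q.1) :
    ∃ l' : List (ℤˣ × Γ), l'.IsChain (fun a b => a.2 ∈ V → a.1 = b.1) ∧
      l'.head?.map Prod.fst = l.head?.map Prod.fst ∧
      ∀ k : ℕ, (l.map fun p => (c * g ^ k) ^ (p.1 : ℤ) * f p.2).prod =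
        (l.head?.elim 1 fun p => preFactor c p.1) *
          (l'.map fun p => (g ^ k) ^ (p.1 : ℤ) * p.2).prod := by
  induction l with
  | nil => exact ⟨[], by simp⟩
  | cons p l ih =>
    rw [List.isChain_cons] at hl
    obtain ⟨l', h1, h2, h3⟩ := ih hl.2 fun q hq => hR q (List.mem_cons_of_mem _ hq)
    refine ⟨(p.1, postFactor c p.1 * f p.2 * l.head?.elim 1 fun p => preFactor c p.1) :: l',
      ?_, by simp, ?_⟩
    · refine List.isChain_cons.2 ⟨fun q' hq' hV => ?_, h1⟩
      cases l with
      | nil =>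
        cases l' with
        | nil => simp at hq'
        | cons _ _ => simp at h2
      | cons q l =>
        have hq : q.1 = q'.1 := by
          rw [Option.mem_def.1 hq'] at h2
          simpa using h2.symm
        rw [← hq]
        exact hR p List.mem_cons_self q (hl.1 q (by simp)) (by simpa using hV)
    · intro k
      rw [List.map_cons, List.prod_cons, h3, List.map_cons, List.prod_cons, mul_zpow_units]
      simp [mul_assoc]

theorem limitGroupsClosedUnderHNN {Γ : Type u} [Group Γ] (hm : HasMovers Γ)
    (hc : ConjOfFinite Γ) : LimitGroupsClosedUnderHNN Γ := by
  intro H _ F₁ F₂ _ _ α hH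
  refine ⟨?_, isFullyResidually_iff.2 fun E hE hE1 => ?_⟩
  · obtain ⟨S, hS, hfin⟩ := Group.fg_iff.1 hH.1
    exact Group.fg_iff.2 ⟨gens α S, closure_gens hS, (hfin.image _).insert _⟩
  -- the elements of `H` occurring in the elements of `E`
  set L : Set H := {x | ∃ w ∈ E, x = (nf w).head ∨ ∃ u, (u, x) ∈ (nf w).toList} with hLdef
  have hLfin : L.Finite := by
    have h1 : (⋃ w ∈ E, insert (nf w).head (Prod.snd '' {x | x ∈ (nf w).toList})).Finite :=
      hE.biUnion fun w _ => ((List.finite_toSet _).image _).insert _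
    refine h1.subset ?_
    rintro x ⟨w, hw, hx⟩
    simp only [Set.mem_iUnion]
    refine ⟨w, hw, hx.imp id ?_⟩
    rintro ⟨u, hu⟩
    exact ⟨_, hu, rfl⟩
  obtain ⟨f, hf⟩ := hH.2 (L ∪ ((F₁ : Set H) ∪ F₂)) (hLfin.union
    ((Set.toFinite _).union (Set.toFinite _)))
  have hinj₁ : Function.Injective (f.comp F₁.subtype) := fun x y hxy =>
    Subtype.ext (hf (Or.inr (Or.inl x.2)) (Or.inr (Or.inl y.2)) hxy)
  have hinj₂ : Function.Injective ((f.comp F₂.subtype).comp α.toMonoidHom) := fun x y hxy =>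
    α.injective (Subtype.ext (hf (Or.inr (Or.inr (α x).2)) (Or.inr (Or.inr (α y).2)) hxy))
  obtain ⟨c, hcα⟩ := hc.exists_conj hinj₁ hinj₂
  have hcα' : ∀ x : F₁, c * f x * c⁻¹ = f (α x) := hcα
  set F := (f.comp F₁.subtype).range with hF
  have : Finite F := MonoidHom.finite_range_of_finite _
  obtain ⟨g, hg, hgX⟩ := hm.exists_avoiding F
    (X := (f '' L ∪ (fun x => c⁻¹ * f x * c) '' L) \ F)
    (((hLfin.image _).union (hLfin.image _)).subset Set.sdiff_subset) (fun x hx => hx.2)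
  have hlt : ∀ (n : ℕ) (a : F₁), c * g ^ n * f a = f (α a) * (c * g ^ n) := by
    intro n a
    have h1 : g ^ n * f a = f a * g ^ n :=
      (Commute.pow_left (hg.comm (f a) ⟨a, rfl⟩ : Commute g (f a)) n).eq
    rw [← hcα', mul_assoc, h1]
    group
  set Ψ : ℕ → HNNExtension H F₁ F₂ α →* Γ := fun n => HNNExtension.lift f (c * g ^ n) (hlt n)
    with hΨ
  have hΨw : ∀ n w, Ψ n w = f (nf w).head *
      ((nf w).toList.map fun p => (c * g ^ n) ^ (p.1 : ℤ) * f p.2).prod := by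
    intro n w
    conv_lhs => rw [← prod_nf w, NormalWord.ReducedWord.prod, map_mul]
    rw [map_list_prod, List.map_map]
    congr 1
    refine congrArg List.prod (List.map_congr_left fun x _ => ?_)
    simp [hΨ]
  obtain ⟨n, hn⟩ := exists_uniform (P := fun w n => Ψ n w ≠ 1) hE (by
    intro w hw
    by_cases hnil : (nf w).toList = []
    · refine ⟨0, fun n _ h1 => hE1 w hw ?_⟩
      rw [hΨw, hnil, List.map_nil, List.prod_nil, mul_one, ← map_one f] at h1
      have h2 := hf (Or.inl ⟨w, hw, Or.inl rfl⟩) (Or.inr (Or.inl (one_mem F₁))) h1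
      rw [← prod_nf w, NormalWord.ReducedWord.prod, hnil, h2]
      simp
    · obtain ⟨l, hl1, hl2, hl3⟩ := exists_spread_hnn f c g (zpowers g ⊔ F) _ (nf w).toList
        (nf w).chain (by
          rintro ⟨ε, h⟩ hp ⟨ε', h'⟩ hR hV
          dsimp only at hR hV ⊢
          by_contra hne
          have hL : h ∈ L := ⟨w, hw, Or.inr ⟨ε, hp⟩⟩
          have hh : h ∉ toSubgroup F₁ F₂ ε := fun hh => hne (hR hh)
          -- For `t * h * t⁻¹` the separating element is `f h`, and it must stay outside the image
          -- of `F₁`. For `t⁻¹ * h * t` it is `c⁻¹ * f h * c`, which lies in that image only if `h`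
          -- is in `F₂`. This is why both sets of elements were avoided.
          rcases Int.units_eq_one_or ε with rfl | rfl
          · obtain rfl : ε' = -1 := by
              rcases Int.units_eq_one_or ε' with rfl | rfl
              · exact absurd rfl hne
              · rfl
            simp only [postFactor, preFactor, if_true, one_mul] at hV
            rw [if_neg (by decide), mul_one] at hV
            refine hgX _ ⟨Or.inl ⟨h, hL, rfl⟩, ?_⟩ hV
            rintro ⟨x, hx⟩
            exact hh (hf (Or.inr (Or.inl x.2)) (Or.inl hL) hx ▸ x.2)
          · obtain rfl : ε' = 1 := by
              rcases Int.units_eq_one_or ε' with rfl | rfl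
              · rfl
              · exact absurd rfl hne
            simp only [postFactor, preFactor, if_true] at hV
            rw [if_neg (by decide)] at hV
            refine hgX _ ⟨Or.inr ⟨h, hL, rfl⟩, ?_⟩ hV
            rintro ⟨x, hx⟩
            have hx' : f x = c⁻¹ * f h * c := hx
            have h1 := hcα' x
            rw [hx'] at h1
            have h2 : f h = f (α x) := by rw [← h1]; group
            exact hh (hf (Or.inr (Or.inr (α x).2)) (Or.inl hL) h2.symm ▸ (α x).2))
      obtain ⟨p, l₀, hl₀⟩ := List.exists_cons_of_ne_nil hnil
      obtain ⟨K, hK⟩ := hg.prod_ne_one l (by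
        rintro rfl
        simp [hl₀] at hl2) hl1
        (f (nf w).head * ((nf w).toList.head?.elim 1 fun p => preFactor c p.1))
      exact ⟨K, fun n hn => by rw [hΨw, hl3, ← mul_assoc]; exact hK n hn⟩)
  exact ⟨Ψ n, hn⟩

end HNN

universe v

/-! ### Multiple HNN extensions -/

section MultiHNN

open Monoid

variable {Γ : Type u} [Group Γ] {I : Type v} {A B : I → Subgroup Γ}

/-- The relations `t i * a * (t i)⁻¹ = φ i a` of a multiple HNN extension. -/
def multiHNNRels (φ : ∀ i, A i ≃* B i) : Set (Coprod Γ (FreeGroup I)) :=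
  {x | ∃ (i : I) (a : A i), x = Coprod.inr (FreeGroup.of i) * Coprod.inl (a : Γ) *
    (Coprod.inr (FreeGroup.of i))⁻¹ * (Coprod.inl (φ i a : Γ))⁻¹}

/-- The multiple HNN extension of a group along a family of isomorphisms between subgroups. -/
def MultiHNN (φ : ∀ i, A i ≃* B i) : Type (max u v) :=
  Coprod Γ (FreeGroup I) ⧸ Subgroup.normalClosure (multiHNNRels φ)

variable {φ : ∀ i, A i ≃* B i}

noncomputable instance : Group (MultiHNN φ) :=
  inferInstanceAs (Group (Coprod Γ (FreeGroup I) ⧸ Subgroup.normalClosure (multiHNNRels φ)))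

namespace MultiHNN

variable (φ) in
/-- The inclusion of the base group. -/
def of : Γ →* MultiHNN φ := (QuotientGroup.mk' _).comp Coprod.inl

variable (φ) in
/-- The stable letters. -/
def t (i : I) : MultiHNN φ :=
  QuotientGroup.mk' (Subgroup.normalClosure (multiHNNRels φ)) (Coprod.inr (FreeGroup.of i))

theorem t_mul_of (i : I) (a : A i) : t φ i * of φ (a : Γ) = of φ (φ i a : Γ) * t φ i := by
  have h : QuotientGroup.mk' (Subgroup.normalClosure (multiHNNRels φ))
      (Coprod.inr (FreeGroup.of i) * Coprod.inl (a : Γ) *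
        (Coprod.inr (FreeGroup.of i))⁻¹ * (Coprod.inl (φ i a : Γ))⁻¹) = 1 :=
    (QuotientGroup.eq_one_iff _).2 (Subgroup.subset_normalClosure ⟨i, a, rfl⟩)
  rw [map_mul, map_inv, map_mul, map_inv, map_mul, mul_inv_eq_one, mul_inv_eq_iff_eq_mul] at h
  exact h

variable {H : Type*} [Group H]

/-- The homomorphism defined by its values on the base group and on the stable letters. -/
def lift (f : Γ →* H) (x : I → H) (hx : ∀ i, ∀ a : A i, x i * f a = f (φ i a) * x i) :
    MultiHNN φ →* H :=
  QuotientGroup.lift _ (Coprod.lift f (FreeGroup.lift x)) (by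
    have h : Subgroup.normalClosure (multiHNNRels φ) ≤
        (Coprod.lift f (FreeGroup.lift x)).ker := by
      refine Subgroup.normalClosure_le_normal ?_
      rintro _ ⟨i, a, rfl⟩
      change Coprod.lift f (FreeGroup.lift x) _ = 1
      simp [hx]
    exact fun y hy => h hy)

@[simp]
theorem lift_of (f : Γ →* H) (x : I → H) (hx : ∀ i, ∀ a : A i, x i * f a = f (φ i a) * x i)
    (g : Γ) : lift f x hx (of φ g) = f g :=
  Coprod.lift_apply_inl f (FreeGroup.lift x) g

@[simp]
theorem lift_t (f : Γ →* H) (x : I → H) (hx : ∀ i, ∀ a : A i, x i * f a = f (φ i a) * x i)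
    (i : I) : lift f x hx (t φ i) = x i :=
  (Coprod.lift_apply_inr f (FreeGroup.lift x) (FreeGroup.of i)).trans FreeGroup.lift_apply_of

theorem hom_ext {f g : MultiHNN φ →* H} (h : ∀ x, f (of φ x) = g (of φ x))
    (ht : ∀ i, f (t φ i) = g (t φ i)) : f = g := by
  refine QuotientGroup.monoidHom_ext _ (Coprod.hom_ext (MonoidHom.ext h) ?_)
  exact FreeGroup.ext_hom _ _ ht

variable (φ) in
/-- A multiple HNN extension without stable letters is the base group. -/
noncomputable def equivOfIsEmpty [IsEmpty I] : Γ ≃* MultiHNN φ :=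
  (of φ).toMulEquiv (lift (MonoidHom.id Γ) isEmptyElim fun i => isEmptyElim i)
    (by ext; simp) (hom_ext (by simp) fun i => isEmptyElim i)

variable (φ) in
/-- The family of isomorphisms with one index left out. -/
abbrev erase (i₀ : I) : ∀ j : {j // j ≠ i₀}, A j ≃* B j := fun j => φ j

/-- The isomorphism defining the last one of the HNN extensions. -/
noncomputable def lastIso {i₀ : I} (h : Function.Injective (of (erase φ i₀))) :
    (A i₀).map (of (erase φ i₀)) ≃* (B i₀).map (of (erase φ i₀)) :=
  (((A i₀).equivMapOfInjective _ h).symm.trans (φ i₀)).trans ((B i₀).equivMapOfInjective _ h)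

theorem lastIso_apply {i₀ : I} (h : Function.Injective (of (erase φ i₀))) (a : A i₀) :
    lastIso h ⟨of (erase φ i₀) a, ⟨a, a.2, rfl⟩⟩ = of (erase φ i₀) (φ i₀ a) := by
  have : (⟨of (erase φ i₀) a, ⟨a, a.2, rfl⟩⟩ : (A i₀).map (of (erase φ i₀))) =
      (A i₀).equivMapOfInjective _ h a := rfl
  rw [this, lastIso, MulEquiv.trans_apply, MulEquiv.trans_apply, MulEquiv.symm_apply_apply]
  rfl

open Classical in
/-- A multiple HNN extension is a single HNN extension of the one with a stable letter less. -/
noncomputable def equivHNN {i₀ : I} (h : Function.Injective (of (erase φ i₀))) :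
    HNNExtension (MultiHNN (erase φ i₀)) _ _ (lastIso h) ≃* MultiHNN φ :=
  (HNNExtension.lift (lift (φ := erase φ i₀) (of φ) (fun j => t φ j) fun j a => t_mul_of (φ := φ) j a)
    (t φ i₀)
    (by
      rintro ⟨_, a, ha, rfl⟩
      have := lastIso_apply h ⟨a, ha⟩
      rw [this, lift_of, lift_of]
      exact t_mul_of i₀ ⟨a, ha⟩)).toMulEquiv
  (lift (HNNExtension.of.comp (of _))
    (fun i => if hi : i = i₀ then HNNExtension.t else HNNExtension.of (t (erase φ i₀) ⟨i, hi⟩)) (by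
      intro i a
      by_cases hi : i = i₀
      · subst hi
        rw [dif_pos rfl]
        have := HNNExtension.t_mul_of (φ := lastIso h) ⟨of (erase φ i) a, ⟨a, a.2, rfl⟩⟩
        rw [lastIso_apply h a] at this
        exact this
      · rw [dif_neg hi, MonoidHom.comp_apply, MonoidHom.comp_apply, ← map_mul, ← map_mul]
        exact congrArg _ (t_mul_of (φ := erase φ i₀) ⟨i, hi⟩ a)))
  (HNNExtension.hom_ext (hom_ext (by simp) fun j => by simp [j.2]) (by simp))
  (hom_ext (by simp) fun i => by
    by_cases hi : i = i₀
    · subst hi; simp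
    · simp [hi])

theorem equivHNN_of {i₀ : I} (h : Function.Injective (of (erase φ i₀))) (g : Γ) :
    equivHNN h (HNNExtension.of (of _ g)) = of φ g := by
  simp [equivHNN]

theorem equivHNN_t {i₀ : I} (h : Function.Injective (of (erase φ i₀))) :
    equivHNN h HNNExtension.t = t φ i₀ := by
  simp [equivHNN]

end MultiHNN

end MultiHNN

/-- Every finite subgroup is conjugate into the range of `f`. -/
def FiniteConjInto {G Q : Type*} [Group G] [Group Q] (f : G →* Q) : Prop :=
  ∀ K : Subgroup Q, Finite K → ∃ c, ∀ k ∈ K, ∃ g, c⁻¹ * k * c = f g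

theorem FiniteConjInto.of_surjective {G Q : Type*} [Group G] [Group Q] {f : G →* Q}
    (hf : Function.Surjective f) : FiniteConjInto f :=
  fun _ _ => ⟨1, fun _ _ => (hf _).imp fun _ h => h.symm⟩

theorem Subgroup.finite_map {G Q : Type*} [Group G] [Group Q] (K : Subgroup G) [Finite K]
    (f : G →* Q) : Finite (K.map f) :=
  ((Set.toFinite (K : Set G)).image f).to_subtype

theorem Subgroup.finite_comap {G Q : Type*} [Group G] [Group Q] (K : Subgroup Q) [Finite K]
    {f : G →* Q} (hf : Function.Injective f) : Finite (K.comap f) :=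
  ((Set.toFinite (K : Set Q)).preimage hf.injOn).to_subtype

theorem FiniteConjInto.comp {G Q R : Type*} [Group G] [Group Q] [Group R] {g : Q →* R} {f : G →* Q}
    (hg : FiniteConjInto g) (hinj : Function.Injective g) (hf : FiniteConjInto f) :
    FiniteConjInto (g.comp f) := by
  intro K hK
  obtain ⟨c, hc⟩ := hg K hK
  have h1 := K.finite_map (MulAut.conj c⁻¹).toMonoidHom
  have h2 := (K.map (MulAut.conj c⁻¹).toMonoidHom).finite_comap hinj
  obtain ⟨c', hc'⟩ := hf _ h2
  refine ⟨c * g c', fun k hk => ?_⟩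
  obtain ⟨q, hq⟩ := hc k hk
  obtain ⟨x, hx⟩ := hc' q ⟨k, hk, by simpa using hq⟩
  refine ⟨x, ?_⟩
  rw [MonoidHom.comp_apply, ← hx, map_mul, map_mul, map_inv, ← hq]
  group

/-- Induction on the number of stable letters. The three conclusions go together because injectivity
on the base group is needed to present the next step as an ordinary HNN extension. -/
theorem MultiHNN.main {Γ : Type u} [Group Γ] (hΓ : IsHyperbolicGroup Γ) (n : ℕ) :
    ∀ (I : Type v) [Finite I] (A B : I → Subgroup Γ) (φ : ∀ i, A i ≃* B i), Nat.card I = n →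
      (∀ i, Finite (A i)) → Function.Injective (of φ) ∧ IsHyperbolicGroup (MultiHNN φ) ∧
        FiniteConjInto (of φ) := by
  induction n with
  | zero =>
    intro I _ A B φ hI _
    have : IsEmpty I := Finite.card_eq_zero_iff.1 hI
    exact ⟨(equivOfIsEmpty φ).injective, hΓ.of_mulEquiv (equivOfIsEmpty φ),
      .of_surjective (equivOfIsEmpty φ).surjective⟩
  | succ n ih =>
    intro I _ A B φ hI hA
    have : Nonempty I := (Nat.card_pos_iff.1 (by omega)).1
    obtain ⟨i₀⟩ := this
    have hcard : Nat.card {j // j ≠ i₀} = n := by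
      classical
      have := Fintype.ofFinite I
      rw [Nat.card_eq_fintype_card] at hI ⊢
      rw [Fintype.card_subtype_compl, hI]
      simp
    obtain ⟨h1, h2, h3⟩ := ih {j // j ≠ i₀} (fun j => A j) (fun j => B j) (erase φ i₀) hcard
      fun j => hA j
    have hfA := hA i₀
    have hfB : Finite (B i₀) := Finite.of_equiv _ (φ i₀).toEquiv
    have hfA' := (A i₀).finite_map (of (erase φ i₀))
    have hfB' := (B i₀).finite_map (of (erase φ i₀))
    have hcomp : of φ = (equivHNN h1).toMonoidHom.comp (HNNExtension.of.comp (of (erase φ i₀))) :=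
      MonoidHom.ext fun g => (equivHNN_of h1 g).symm
    refine ⟨?_, (HNNExtension.isHyperbolicGroup h2).of_mulEquiv (equivHNN h1), ?_⟩
    · rw [hcomp]
      exact (equivHNN h1).injective.comp ((HNNExtension.of_injective _).comp h1)
    · rw [hcomp]
      refine FiniteConjInto.comp (.of_surjective (equivHNN h1).surjective)
        (equivHNN h1).injective (FiniteConjInto.comp ?_ (HNNExtension.of_injective _) h3)
      exact fun K _ => HNNExtension.exists_conj_of_finite K

theorem HNNExtension.isMover_t_of_eq {P : Type*} [Group P] {A B : Subgroup P} {φ : A ≃* B}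
    (h : A = B) (hφ : ∀ a, (φ a : P) = a) :
    IsMover (A.map (of : P →* HNNExtension P A B φ)) t := by
  subst h
  exact isMover_t fun a => Subtype.ext (hφ a)

/-- The order of the HNN extensions is arbitrary, so the given stable letter may be adjoined last.
-/
theorem MultiHNN.isMover_t {Γ : Type u} [Group Γ] (hΓ : IsHyperbolicGroup Γ) {I : Type v} [Finite I]
    {A B : I → Subgroup Γ} {φ : ∀ i, A i ≃* B i} (hA : ∀ i, Finite (A i)) (i₀ : I)
    (hAB : A i₀ = B i₀) (hφ : ∀ a, (φ i₀ a : Γ) = a) :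
    IsMover ((A i₀).map (of φ)) (t φ i₀) := by
  obtain ⟨h1, -, -⟩ := MultiHNN.main hΓ _ {j // j ≠ i₀} (fun j => A j) (fun j => B j) (erase φ i₀)
    rfl fun j => hA j
  have h := (HNNExtension.isMover_t_of_eq (φ := lastIso h1) (by rw [hAB]) (by
    rintro ⟨_, a, ha, rfl⟩
    exact (lastIso_apply h1 ⟨a, ha⟩).trans (congrArg _ (hφ _)))).map (equivHNN h1)
  rw [equivHNN_t, Subgroup.map_map, Subgroup.map_map] at h
  have hcomp : ((equivHNN h1).toMonoidHom.comp HNNExtension.of).comp (of (erase φ i₀)) = of φ :=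
    MonoidHom.ext fun g => equivHNN_of h1 g
  rwa [hcomp] at h

/-! ### The torsion-saturated hyperbolic group -/

namespace Saturation

open MultiHNN Subgroup

variable {Γ : Type u} [Group Γ]

/-- The subgroups contained in the set `T`. -/
abbrev Sub (T : Set Γ) : Type u := {F : Subgroup Γ // (F : Set Γ) ⊆ T}

/-- The isomorphisms between subgroups contained in `T`, each of them taken twice. -/
abbrev Index (T : Set Γ) : Type u := Σ p : Sub T × Sub T, (p.1.1 ≃* p.2.1) × Bool

/-- The isomorphism belonging to an index. -/
abbrev iso (T : Set Γ) (i : Index T) : i.1.1.1 ≃* i.1.2.1 := i.2.1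

/-- The group in which all isomorphisms between subgroups contained in `T` become conjugations. -/
abbrev Saturated (T : Set Γ) : Type u := MultiHNN (iso T)

variable {T : Set Γ}

theorem finite_sub (hT : T.Finite) (F : Sub T) : Finite F.1 :=
  (hT.subset F.2).to_subtype

theorem finite_index (hT : T.Finite) : Finite (Index T) := by
  have h1 : Finite (Sub T) := by
    have := hT.finite_subsets.to_subtype
    exact Finite.of_injective (fun F : Sub T => (⟨F.1, F.2⟩ : {S : Set Γ | S ⊆ T}))
      fun F F' h => Subtype.ext (SetLike.coe_injective (congrArg Subtype.val h))
  have h2 : ∀ p : Sub T × Sub T, Finite (p.1.1 ≃* p.2.1) := fun p => by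
    have := finite_sub hT p.1
    have := finite_sub hT p.2
    exact Finite.of_injective (fun e : p.1.1 ≃* p.2.1 => (e : p.1.1 → p.2.1)) DFunLike.coe_injective
  infer_instance

theorem exists_eq_map (hT : T.Finite)
    (hconj : ∀ K : Subgroup Γ, Finite K → ∃ c, ∀ k ∈ K, c⁻¹ * k * c ∈ T) (hΓ : IsHyperbolicGroup Γ)
    (K : Subgroup (Saturated T)) [Finite K] : ∃ (c : Saturated T) (F : Sub T),
      K = F.1.map ((MulAut.conj c).toMonoidHom.comp (of (iso T))) := by
  have := finite_index hT
  obtain ⟨hinj, -, hfc⟩ := MultiHNN.main hΓ _ (Index T) _ _ (iso T) rfl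
    fun i => finite_sub hT i.1.1
  obtain ⟨c, hc⟩ := hfc K inferInstance
  have h1 := K.finite_map (MulAut.conj c⁻¹).toMonoidHom
  have h2 := (K.map (MulAut.conj c⁻¹).toMonoidHom).finite_comap hinj
  obtain ⟨γ, hγ⟩ := hconj _ h2
  -- Two conjugations are composed: `c` moves `K` into the image of `Γ`, and `γ` moves it into `T`
  -- inside `Γ`.
  refine ⟨c * of _ γ, ⟨((K.map (MulAut.conj c⁻¹).toMonoidHom).comap (of (iso T))).map
    (MulAut.conj γ⁻¹).toMonoidHom, ?_⟩, ?_⟩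
  · rintro _ ⟨x, hx, rfl⟩
    simpa using hγ x hx
  · ext k
    constructor
    · intro hk
      obtain ⟨x, hx⟩ := hc k hk
      refine ⟨γ⁻¹ * x * γ, ⟨x, ⟨k, hk, by simpa using hx⟩, by simp⟩, ?_⟩
      change c * of (iso T) γ * of (iso T) (γ⁻¹ * x * γ) * (c * of (iso T) γ)⁻¹ = k
      rw [map_mul, map_mul, map_inv, ← hx]
      group
    · rintro ⟨_, ⟨x, ⟨k', hk', hx⟩, rfl⟩, rfl⟩
      have hx' : c⁻¹ * k' * c = of (iso T) x := by simpa using hx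
      have : (MulAut.conj (c * of (iso T) γ)).toMonoidHom.comp (of (iso T))
          ((MulAut.conj γ⁻¹).toMonoidHom x) = k' := by
        change c * of (iso T) γ * of (iso T) (γ⁻¹ * x * γ⁻¹⁻¹) * (c * of (iso T) γ)⁻¹ = k'
        rw [inv_inv, map_mul, map_mul, map_inv, ← hx']
        group
      rwa [this]

theorem conjOfFinite (hT : T.Finite)
    (hconj : ∀ K : Subgroup Γ, Finite K → ∃ c, ∀ k ∈ K, c⁻¹ * k * c ∈ T)
    (hΓ : IsHyperbolicGroup Γ) : ConjOfFinite (Saturated T) := by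
  intro K₁ K₂ α hK₁ hK₂
  have := finite_index hT
  obtain ⟨hinj, -, -⟩ := MultiHNN.main hΓ _ (Index T) _ _ (iso T) rfl
    fun i => finite_sub hT i.1.1
  obtain ⟨c₁, F₁, rfl⟩ := exists_eq_map hT hconj hΓ K₁
  obtain ⟨c₂, F₂, rfl⟩ := exists_eq_map hT hconj hΓ K₂
  have hi : ∀ c : Saturated T, Function.Injective
      ((MulAut.conj c).toMonoidHom.comp (of (iso T))) := fun c =>
    (MulAut.conj c).injective.comp hinj
  set e₁ := F₁.1.equivMapOfInjective _ (hi c₁)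
  set e₂ := F₂.1.equivMapOfInjective _ (hi c₂)
  have he₁ : ∀ x : F₁.1, (e₁ x : Saturated T) = c₁ * of _ (x : Γ) * c₁⁻¹ := fun _ => rfl
  have he₂ : ∀ x : F₂.1, (e₂ x : Saturated T) = c₂ * of _ (x : Γ) * c₂⁻¹ := fun _ => rfl
  set β : F₁.1 ≃* F₂.1 := (e₁.trans α).trans e₂.symm with hβ
  -- Transported to subgroups in `T`, the isomorphism is one of those for which a stable letter was
  -- adjoined; either copy would do.
  let i : Index T := ⟨(F₁, F₂), β, true⟩
  refine ⟨c₂ * t (iso T) i * c₁⁻¹, fun y => ?_⟩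
  obtain ⟨x, rfl⟩ := e₁.surjective y
  have h1 : α (e₁ x) = e₂ (β x) := (e₂.apply_symm_apply _).symm
  have h2 : t (iso T) i * of (iso T) (x : Γ) = of (iso T) (β x : Γ) * t (iso T) i :=
    t_mul_of (φ := iso T) i x
  rw [h1, he₁, he₂]
  calc _ = c₂ * (t (iso T) i * of (iso T) (x : Γ)) * (t (iso T) i)⁻¹ * c₂⁻¹ := by group
    _ = _ := by rw [h2]; group

theorem hasMovers (hT : T.Finite)
    (hconj : ∀ K : Subgroup Γ, Finite K → ∃ c, ∀ k ∈ K, c⁻¹ * k * c ∈ T)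
    (hΓ : IsHyperbolicGroup Γ) : HasMovers (Saturated T) := by
  intro K hK
  have := finite_index hT
  obtain ⟨c, F, rfl⟩ := exists_eq_map hT hconj hΓ K
  -- Here both copies of the identity of `F` are needed: one stable letter is the mover, and the
  -- other commutes with `F` independently of it.
  let i : Bool → Index T := fun b => ⟨(F, F), MulEquiv.refl _, b⟩
  have hii : i false ≠ i true := fun h => by simp [i] at h
  have hm := (MultiHNN.isMover_t (φ := iso T) hΓ (fun i => finite_sub hT i.1.1) (i false) rfl
    fun _ => rfl).conj c
  rw [Subgroup.map_map] at hm
  refine ⟨_, c * t (iso T) (i true) * c⁻¹, hm, ?_, ?_⟩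
  · rintro _ ⟨f, hf, rfl⟩
    have h2 : t (iso T) (i true) * of (iso T) f = of (iso T) f * t (iso T) (i true) :=
      t_mul_of (φ := iso T) (i true) ⟨f, hf⟩
    change c * t (iso T) (i true) * c⁻¹ * (c * of (iso T) f * c⁻¹) =
      c * of (iso T) f * c⁻¹ * (c * t (iso T) (i true) * c⁻¹)
    calc _ = c * (t (iso T) (i true) * of (iso T) f) * c⁻¹ := by group
      _ = _ := by rw [h2]; group
  · intro n hn hmem
    obtain ⟨m, _, ⟨f, hf, rfl⟩, hmf⟩ := (mem_zpowers_sup_iff hm.comm).1 hmem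
    classical
    -- the exponent sum of the second stable letter
    let χ : Saturated T →* Multiplicative ℤ := lift 1
      (fun j => if j = i true then Multiplicative.ofAdd 1 else 1) (by simp)
    have h1 := congrArg χ hmf
    have h2 : χ (((MulAut.conj c).toMonoidHom.comp (of (iso T))) f) = 1 := by simp [χ]
    rw [map_mul, h2, conj_zpow, conj_zpow] at h1
    simp [χ, hii] at h1
    exact hn h1

end Saturation

/-- Every hyperbolic group embeds into a torsion-saturated hyperbolic group `Γ'` such that the
class of `Γ'`-limit groups is closed under amalgamated free products and HNN extensions over finite
groups. -/
theorem mainTheorem7 (Γ : Type u) [Group Γ] (hΓ : IsHyperbolicGroup Γ) :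
    ∃ (Γ' : Type u) (_ : Group Γ'),
      IsHyperbolicGroup Γ' ∧ IsTorsionSaturated Γ' ∧
      LimitGroupsClosedUnderAmalgams Γ' ∧ LimitGroupsClosedUnderHNN Γ' ∧
      ∃ ι : Γ →* Γ', Function.Injective ι := by
  obtain ⟨T, hT, hconj⟩ := hΓ.exists_finite_conj
  have hm := Saturation.hasMovers hT hconj hΓ
  have hc := Saturation.conjOfFinite hT hconj hΓ
  have := Saturation.finite_index hT
  obtain ⟨hinj, hhyp, -⟩ := MultiHNN.main hΓ _ (Saturation.Index T) _ _ (Saturation.iso T) rfl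
    fun i => Saturation.finite_sub hT i.1.1
  exact ⟨Saturation.Saturated T, inferInstance, hhyp, hm.isTorsionSaturated hc,
    limitGroupsClosedUnderAmalgams hm hc, limitGroupsClosedUnderHNN hm hc, _, hinj⟩
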